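/- **Proposition ($\pi$ onto $(M,\varphi_1,h)$ totally geodesic).** All objects are of class $C^\infty$. Let $M$ be a manifold of dimension $2k$. An almost paracomplex structure on $M$ is a $(1,1)$-tensor field $\varphi$ with $\varphi^2=\mathrm{id}$ whose eigenbundles for the eigenvalues $+1$ and $-1$ have the same rank; a Riemannian metric $g$ is anti-paraHermitian with respect to $\varphi$ if $g(\varphi X,\varphi Y)=g(X,Y)$ for all $X,Y$, and $(M,\varphi,g)$ is anti-paraKähler if moreover $\nabla\varphi=0$ for the Levi-Civita connection $\nabla$ of $g$. Let $(M,\varphi,g)$ be anti-paraKähler, let $\delta\in\mathbb{R}$, and let $g_{BS}$ be the Berger type deformed Sasaki metric on $TM$: at $u\in TM$, with ${}^{H}X$ and ${}^{V}X$ the horizontal lift (with respect to $\nabla$) and the vertical lift of $X$, $$g_{BS}({}^{H}X,{}^{H}Y)=g(X,Y),\quad g_{BS}({}^{V}X,{}^{H}Y)=g_{BS}({}^{H}X,{}^{V}Y)=0,\quad g_{BS}({}^{V}X,{}^{V}Y)=g(X,Y)+\delta^2 g(X,\varphi u)\,g(Y,\varphi u).$$ Let $\varphi_1$ be a further almost paracomplex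 structure on $M$ and $h$ a Riemannian metric on $M$ that is anti-paraHermitian with respect to $\varphi_1$. Then the canonical projection $\pi:(TM,g_{BS})\to(M,\varphi_1,h)$ is totally geodesic if and only if $(M,\varphi,g)$ is locally flat (its Riemann curvature tensor vanishes identically) and the identity map $I:(M,\varphi,g)\to(M,\varphi_1,h)$ is totally geodesic. Here a smooth map $f$ from a Riemannian manifold $M$ to a Riemannian manifold $N$ is totally geodesic if its second fundamental form vanishes identically, that is, if in local coordinates $$\frac{\partial^2 f^\gamma}{\partial x^i\partial x^j}-{}^{M}\Gamma_{ij}^{k}\frac{\partial f^\gamma}{\partial x^k}+{}^{N}\Gamma_{\alpha\beta}^{\gamma}\frac{\partial f^\alpha}{\partial x^i}\frac{\partial f^\beta}{\partial x^j}=0 .$$ -/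

import Mathlib

set_option maxSynthPendingDepth 3

open Bundle Module
open scoped Manifold ContDiff

namespace BergerSasaki

noncomputable section

section LocalCoordinates

variable {E : Type*} [NormedAddCommGroup E] [NormedSpace ℝ E]

/-- The Christoffel map `Γ_y(u, v)` of a metric `g` given on (an open part of) a coordinate space,
that is the vector characterised by
`g_y(Γ_y(u, v), w) = (1/2) (∂_u g(v, w) + ∂_v g(u, w) - ∂_w g(u, v))`. In coordinates,
`Γ(∂_i, ∂_j) = Γ^k_{ij} ∂_k` with `Γ^k_{ij} = (1/2) g^{kl} (∂_i g_{jl} + ∂_j g_{il} - ∂_l g_{ij})`.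
Here `(g y).inverse` raises an index. -/
def christoffel (g : E → E →L[ℝ] E →L[ℝ] ℝ) (y u : E) : E →L[ℝ] E :=
  (g y).inverse.comp ((2⁻¹ : ℝ) •
    (fderiv ℝ g y u + (fderiv ℝ g y).flip u - ((fderiv ℝ g y).flip u).flip))

theorem christoffel_spec (g : E → E →L[ℝ] E →L[ℝ] ℝ) (y u v w : E) (hg : (g y).IsInvertible) :
    g y (christoffel g y u v) w =
      2⁻¹ * (fderiv ℝ g y u v w + fderiv ℝ g y v u w - fderiv ℝ g y w u v) := by
  obtain ⟨e, he⟩ := hg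
  simp [christoffel, ← he]

/-- The curvature tensor `R(u, v) w = ∇_u ∇_v w - ∇_v ∇_u w` (for constant coordinate fields
`u, v, w`) of the Levi-Civita connection of `g`, written out through the Christoffel map. -/
def curvature (g : E → E →L[ℝ] E →L[ℝ] ℝ) (y u v w : E) : E :=
  fderiv ℝ (fun z ↦ christoffel g z v w) y u - fderiv ℝ (fun z ↦ christoffel g z u w) y v
    + christoffel g y u (christoffel g y v w) - christoffel g y v (christoffel g y u w)

/-- The covariant derivative `(∇_u A) w` of a field of endomorphisms `A`, for the Levi-Civita
connection of `g`. -/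
def covDerivEndo (g : E → E →L[ℝ] E →L[ℝ] ℝ) (A : E → E →L[ℝ] E) (y u w : E) : E :=
  fderiv ℝ A y u w + christoffel g y u (A y w) - A y (christoffel g y u w)

/-- The second fundamental form
`β(f)(u, v) = ∂_u ∂_v f - df(Γ(u, v)) + Γ'(df u, df v)` of a map `f` between coordinate spaces
with metrics `g` and `g'`. -/
def secondFundamentalForm {E' : Type*} [NormedAddCommGroup E'] [NormedSpace ℝ E']
    (g : E → E →L[ℝ] E →L[ℝ] ℝ) (g' : E' → E' →L[ℝ] E' →L[ℝ] ℝ) (f : E → E') (y u v : E) : E' :=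
  fderiv ℝ (fderiv ℝ f) y u v - fderiv ℝ f y (christoffel g y u v)
    + christoffel g' (f y) (fderiv ℝ f y u) (fderiv ℝ f y v)

end LocalCoordinates

section Manifolds

variable {E : Type*} [NormedAddCommGroup E] [NormedSpace ℝ E]
  {H : Type*} [TopologicalSpace H] (I : ModelWithCorners ℝ E H)
  {M : Type*} [TopologicalSpace M] [ChartedSpace H M]
  {E' : Type*} [NormedAddCommGroup E'] [NormedSpace ℝ E']
  {H' : Type*} [TopologicalSpace H'] (I' : ModelWithCorners ℝ E' H')
  {M' : Type*} [TopologicalSpace M'] [ChartedSpace H' M']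

/-- The expression of a field of bilinear forms on tangent spaces in the chart at `x₀`: its
pullback under the inverse of the chart. All manifolds below are without boundary. -/
def chartForm (G : ∀ x : M, TangentSpace I x →L[ℝ] TangentSpace I x →L[ℝ] ℝ) (x₀ : M) (y : E) :
    E →L[ℝ] E →L[ℝ] ℝ :=
  ContinuousLinearMap.bilinearComp (E := E) (F := E)
    (G ((extChartAt I x₀).symm y))
    (mfderiv 𝓘(ℝ, E) I (extChartAt I x₀).symm y)
    (mfderiv 𝓘(ℝ, E) I (extChartAt I x₀).symm y)

/-- The expression of a field of endomorphisms of tangent spaces in the chart at `x₀`. -/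
def chartEndo (A : ∀ x : M, TangentSpace I x →L[ℝ] TangentSpace I x) (x₀ : M) (y : E) :
    E →L[ℝ] E :=
  (mfderiv I 𝓘(ℝ, E) (extChartAt I x₀) ((extChartAt I x₀).symm y)).comp
    ((A ((extChartAt I x₀).symm y)).comp (mfderiv 𝓘(ℝ, E) I (extChartAt I x₀).symm y))

/-- A smooth map `f : (M, G) → (M', G')` is totally geodesic if its second fundamental form
vanishes at every point (computed in the charts at `x` and `f x`; this is a tensorial
condition). -/
def IsTotallyGeodesic (G : ∀ x : M, TangentSpace I x →L[ℝ] TangentSpace I x →L[ℝ] ℝ)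
    (G' : ∀ x : M', TangentSpace I' x →L[ℝ] TangentSpace I' x →L[ℝ] ℝ) (f : M → M') : Prop :=
  ContMDiff I I' ∞ f ∧ ∀ (x : M) (u v : E),
    secondFundamentalForm (chartForm I G x) (chartForm I' G' (f x))
      (writtenInExtChartAt I I' x f) (extChartAt I x x) u v = 0

/-- The metric `G` is locally flat: its Riemann curvature tensor vanishes identically. -/
def IsLocallyFlat (G : ∀ x : M, TangentSpace I x →L[ℝ] TangentSpace I x →L[ℝ] ℝ) : Prop :=
  ∀ (x : M) (u v w : E), curvature (chartForm I G x) (extChartAt I x x) u v w = 0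

/-- The endomorphism field `A` is parallel for the Levi-Civita connection of `G`: `∇A = 0`. -/
def IsParallel (G : ∀ x : M, TangentSpace I x →L[ℝ] TangentSpace I x →L[ℝ] ℝ)
    (A : ∀ x : M, TangentSpace I x →L[ℝ] TangentSpace I x) : Prop :=
  ∀ (x : M) (u w : E),
    covDerivEndo (chartForm I G x) (chartEndo I A x) (extChartAt I x x) u w = 0

variable (M) in
/-- An almost paracomplex structure: a smooth field `φ` of endomorphisms of the tangent spaces with
`φ² = id` whose eigenbundles for `1` and `-1` have the same rank. -/
structure AlmostParacomplex [IsManifold I ∞ M] where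
  endo (x : M) : TangentSpace I x →L[ℝ] TangentSpace I x
  contMDiff : ContMDiff I (I.prod 𝓘(ℝ, E →L[ℝ] E)) ∞
    (fun x ↦ TotalSpace.mk' (E →L[ℝ] E)
      (E := fun x : M ↦ TangentSpace I x →L[ℝ] TangentSpace I x) x (endo x))
  sq (x : M) (v : TangentSpace I x) : endo x (endo x v) = v
  rank_eq (x : M) :
    finrank ℝ (End.eigenspace (endo x : TangentSpace I x →ₗ[ℝ] TangentSpace I x) 1) =
      finrank ℝ (End.eigenspace (endo x : TangentSpace I x →ₗ[ℝ] TangentSpace I x) (-1))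

variable (M) in
/-- Smooth Riemannian metrics on `M`. -/
abbrev RiemMetric [IsManifold I ∞ M] :=
  ContMDiffRiemannianMetric I ∞ E (TangentSpace I : M → Type _)

variable {I}

/-- The metric `g` is anti-paraHermitian with respect to `φ`: `g(φX, φY) = g(X, Y)`. -/
def IsAntiParaHermitian [IsManifold I ∞ M] (φ : AlmostParacomplex I M) (g : RiemMetric I M) :
    Prop :=
  ∀ (x : M) (v w : TangentSpace I x), g.inner x (φ.endo x v) (φ.endo x w) = g.inner x v w

/-- `(M, φ, g)` is anti-paraKähler: `g` is anti-paraHermitian and `∇φ = 0`. -/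
def IsAntiParaKahler [IsManifold I ∞ M] (φ : AlmostParacomplex I M) (g : RiemMetric I M) :
    Prop :=
  IsAntiParaHermitian φ g ∧ IsParallel I g.inner φ.endo

/-- The Christoffel map of `g` at `x`, in the chart at `x`. -/
def christoffelAt [IsManifold I ∞ M] (g : RiemMetric I M) (x : M) (u : E) : E →L[ℝ] E :=
  christoffel (chartForm I g.inner x) (extChartAt I x x) u

/-- Components `(a, b)` of a vector `ξ = a^i ∂/∂x^i + b^i ∂/∂u^i` tangent to `TM` at `u`, for the
coordinates `(x^i, u^i)` on `TM` induced by the chart of `M` at the base point of `u`. -/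
def tangentCoords [IsManifold I ∞ M] (u : TangentBundle I M) :
    TangentSpace I.tangent u →L[ℝ] E × E :=
  mfderiv I.tangent 𝓘(ℝ, E × E) (extChartAt I.tangent u) u

/-- Components of a vector tangent to `M` at `x` in the chart at `x`. -/
def baseCoords (x : M) : TangentSpace I x →L[ℝ] E :=
  mfderiv I 𝓘(ℝ, E) (extChartAt I x) x

/-- The horizontal lift `a^i E_i` at `u` of the vector `X = a^i ∂/∂x^i` at the base point of `u`,
where `E_i = ∂/∂x^i - Γ^h_{ij} u^j ∂/∂u^h`. -/
def horizontalLift [IsManifold I ∞ M] (g : RiemMetric I M) (u : TangentBundle I M)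
    (X : TangentSpace I u.proj) : TangentSpace I.tangent u :=
  (tangentCoords u).inverse (baseCoords u.proj X,
    -christoffelAt g u.proj (baseCoords u.proj u.snd) (baseCoords u.proj X))

/-- The vertical lift `a^i ∂/∂u^i` at `u` of the vector `X = a^i ∂/∂x^i` at the base point. -/
def verticalLift [IsManifold I ∞ M] (u : TangentBundle I M) (X : TangentSpace I u.proj) :
    TangentSpace I.tangent u :=
  (tangentCoords u).inverse (0, baseCoords u.proj X)

/-- The horizontal part `π_* ξ = a^i ∂/∂x^i` of `ξ = a^i ∂/∂x^i + b^i ∂/∂u^i` tangent to `TM`. -/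
def horizontalPart [IsManifold I ∞ M] (u : TangentBundle I M) :
    TangentSpace I.tangent u →L[ℝ] TangentSpace I u.proj :=
  mfderiv I.tangent I (TotalSpace.proj : TangentBundle I M → M) u

/-- The vertical part of a vector `ξ = a^i ∂/∂x^i + b^i ∂/∂u^i` tangent to `TM` at `u`, as a vector
tangent to `M` at the base point: `(δu^i)(ξ) ∂/∂x^i`, `δu^i = du^i + Γ^i_{hj} u^j dx^h`. -/
def verticalPart [IsManifold I ∞ M] (g : RiemMetric I M) (u : TangentBundle I M) :
    TangentSpace I.tangent u →L[ℝ] TangentSpace I u.proj :=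
  (baseCoords (I := I) u.proj).inverse.comp
    (((ContinuousLinearMap.snd ℝ E E) +
      (christoffelAt g u.proj (baseCoords u.proj u.snd)).comp
        (ContinuousLinearMap.fst ℝ E E)).comp (tangentCoords u))

/-- The bilinear form `(X, Y) ↦ g(X, Y) + δ² g(X, φu) g(Y, φu)` on the tangent space of `M` at the
base point of `u`. -/
def bergerForm [IsManifold I ∞ M] (φ : AlmostParacomplex I M) (g : RiemMetric I M) (δ : ℝ)
    (u : TangentBundle I M) : TangentSpace I u.proj →L[ℝ] TangentSpace I u.proj →L[ℝ] ℝ :=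
  g.inner u.proj + δ ^ 2 • (g.inner u.proj (φ.endo u.proj u.snd)).smulRight
    (g.inner u.proj (φ.endo u.proj u.snd))

/-- The Berger type deformed Sasaki metric on `TM`: horizontal and vertical vectors are orthogonal,
`g_BS(ᴴX, ᴴY) = g(X, Y)` and `g_BS(ⱽX, ⱽY) = g(X, Y) + δ² g(X, φu) g(Y, φu)`. -/
def bergerSasaki [IsManifold I ∞ M] (φ : AlmostParacomplex I M) (g : RiemMetric I M) (δ : ℝ)
    (u : TangentBundle I M) :
    TangentSpace I.tangent u →L[ℝ] TangentSpace I.tangent u →L[ℝ] ℝ :=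
  ContinuousLinearMap.bilinearComp (E := E) (F := E) (E' := E × E) (F' := E × E)
      (g.inner u.proj) (horizontalPart u) (horizontalPart u) +
    ContinuousLinearMap.bilinearComp (E := E) (F := E) (E' := E × E) (F' := E × E)
      (bergerForm φ g δ u) (verticalPart g u) (verticalPart g u)

theorem tangentCoords_eq [IsManifold I ∞ M] (u : TangentBundle I M) :
    (tangentCoords u : E × E →L[ℝ] E × E) = ContinuousLinearMap.id ℝ (E × E) :=
  mfderiv_extChartAt_self (I := I.tangent)

theorem baseCoords_eq [IsManifold I ∞ M] (x : M) :
    (baseCoords (I := I) x : E →L[ℝ] E) = ContinuousLinearMap.id ℝ E :=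
  mfderiv_extChartAt_self

theorem horizontalPart_eq [IsManifold I ∞ M] [I.Boundaryless] (u : TangentBundle I M) :
    (horizontalPart u : E × E →L[ℝ] E) = ContinuousLinearMap.fst ℝ E E := by
  have hd : MDifferentiableAt I.tangent I (TotalSpace.proj : TangentBundle I M → M) u :=
    (contMDiff_proj (n := 1) (TangentSpace I)).mdifferentiableAt one_ne_zero
  unfold horizontalPart
  rw [hd.mfderiv]
  have h : writtenInExtChartAt I.tangent I u (TotalSpace.proj : TangentBundle I M → M)
      =ᶠ[nhds (extChartAt I.tangent u u)] Prod.fst := by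
    filter_upwards [extChartAt_target_mem_nhds (I := I.tangent) u] with y hy
    have h1 := (extChartAt I.tangent u).right_inv hy
    have h2 : (extChartAt I u.proj) ((extChartAt I.tangent u).symm y).proj = y.1 := by
      have h3 : ((extChartAt I.tangent u) ((extChartAt I.tangent u).symm y)).1 = y.1 := by rw [h1]
      rw [← h3]
      simp [ModelWithCorners.tangent]
    simpa [writtenInExtChartAt] using h2
  rw [I.tangent.range_eq_univ, fderivWithin_univ, h.fderiv_eq]
  exact fderiv_fst

theorem tangentCoords_inverse [IsManifold I ∞ M] (u : TangentBundle I M) (z : E × E) :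
    tangentCoords u ((tangentCoords u).inverse z) = z := by
  have h : (tangentCoords u).IsInvertible :=
    isInvertible_mfderiv_extChartAt (I := I.tangent) (mem_extChartAt_source u)
  obtain ⟨e, he⟩ := h
  rw [← he]
  simp

theorem baseCoords_inverse [IsManifold I ∞ M] (x : M) (X : TangentSpace I x) :
    (baseCoords (I := I) x).inverse (baseCoords x X) = X := by
  have h : (baseCoords (I := I) x).IsInvertible :=
    isInvertible_mfderiv_extChartAt (mem_extChartAt_source x)
  obtain ⟨e, he⟩ := h
  rw [← he]
  simp

theorem horizontalPart_eq' [IsManifold I ∞ M] [I.Boundaryless] (u : TangentBundle I M)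
    (ξ : TangentSpace I.tangent u) :
    horizontalPart u ξ = (baseCoords (I := I) u.proj).inverse (tangentCoords u ξ).1 := by
  rw [← baseCoords_inverse u.proj (horizontalPart u ξ)]
  congr 1
  have h1 : horizontalPart u ξ = (ξ : E × E).1 := congrArg (fun L : E × E →L[ℝ] E ↦ L ξ)
    (horizontalPart_eq u)
  have h2 : tangentCoords u ξ = (ξ : E × E) := congrArg (fun L : E × E →L[ℝ] E × E ↦ L ξ)
    (tangentCoords_eq u)
  have h3 (X : TangentSpace I u.proj) : baseCoords u.proj X = (X : E) :=
    congrArg (fun L : E →L[ℝ] E ↦ L X) (baseCoords_eq u.proj)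
  rw [h3, h2, h1]

section Lifts

variable [IsManifold I ∞ M] (φ : AlmostParacomplex I M) (g : RiemMetric I M) (δ : ℝ)
  (u : TangentBundle I M) (X Y : TangentSpace I u.proj)

theorem horizontalPart_horizontalLift [I.Boundaryless] :
    horizontalPart u (horizontalLift g u X) = X := by
  rw [horizontalPart_eq', horizontalLift, tangentCoords_inverse, baseCoords_inverse]

theorem horizontalPart_verticalLift [I.Boundaryless] :
    horizontalPart u (verticalLift u X) = 0 := by
  rw [horizontalPart_eq', verticalLift, tangentCoords_inverse, map_zero]

theorem verticalPart_apply (ξ : TangentSpace I.tangent u) :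
    verticalPart g u ξ = (baseCoords (I := I) u.proj).inverse ((tangentCoords u ξ).2 +
      christoffelAt g u.proj (baseCoords u.proj u.snd) (tangentCoords u ξ).1) := rfl

theorem verticalPart_horizontalLift : verticalPart g u (horizontalLift g u X) = 0 := by
  rw [verticalPart_apply, horizontalLift, tangentCoords_inverse, neg_add_cancel, map_zero]

theorem verticalPart_verticalLift : verticalPart g u (verticalLift u X) = X := by
  rw [verticalPart_apply, verticalLift, tangentCoords_inverse, map_zero, add_zero,
    baseCoords_inverse]

theorem bergerSasaki_apply (ξ η : TangentSpace I.tangent u) :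
    bergerSasaki φ g δ u ξ η =
      g.inner u.proj (horizontalPart u ξ) (horizontalPart u η) +
      (g.inner u.proj (verticalPart g u ξ) (verticalPart g u η) +
        δ ^ 2 * (g.inner u.proj (φ.endo u.proj u.snd) (verticalPart g u ξ) *
          g.inner u.proj (φ.endo u.proj u.snd) (verticalPart g u η))) := rfl

theorem bergerSasaki_horizontal_horizontal [I.Boundaryless] :
    bergerSasaki φ g δ u (horizontalLift g u X) (horizontalLift g u Y) = g.inner u.proj X Y := by
  simp [bergerSasaki_apply, horizontalPart_horizontalLift, verticalPart_horizontalLift]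

theorem bergerSasaki_vertical_horizontal [I.Boundaryless] :
    bergerSasaki φ g δ u (verticalLift u X) (horizontalLift g u Y) = 0 := by
  simp [bergerSasaki_apply, horizontalPart_verticalLift, verticalPart_horizontalLift]

theorem bergerSasaki_horizontal_vertical [I.Boundaryless] :
    bergerSasaki φ g δ u (horizontalLift g u X) (verticalLift u Y) = 0 := by
  simp [bergerSasaki_apply, horizontalPart_verticalLift, verticalPart_horizontalLift]

theorem bergerSasaki_vertical_vertical [I.Boundaryless] :
    bergerSasaki φ g δ u (verticalLift u X) (verticalLift u Y) =
      g.inner u.proj X Y + δ ^ 2 * g.inner u.proj X (φ.endo u.proj u.snd) *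
        g.inner u.proj Y (φ.endo u.proj u.snd) := by
  simp only [bergerSasaki_apply, horizontalPart_verticalLift, verticalPart_verticalLift, map_zero,
    zero_add, g.symm u.proj (φ.endo u.proj u.snd), mul_assoc]

/-- The Berger type deformed Sasaki metric is positive definite. -/
theorem bergerSasaki_pos [I.Boundaryless] (ξ : TangentSpace I.tangent u) (hξ : ξ ≠ 0) :
    0 < bergerSasaki φ g δ u ξ ξ := by
  have nn (Z : TangentSpace I u.proj) : 0 ≤ g.inner u.proj Z Z := by
    by_cases h : Z = 0
    · simp [h]
    · exact (g.pos _ _ h).le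
  have hb : 0 ≤ δ ^ 2 * (g.inner u.proj (φ.endo u.proj u.snd) (verticalPart g u ξ) *
      g.inner u.proj (φ.endo u.proj u.snd) (verticalPart g u ξ)) :=
    mul_nonneg (sq_nonneg _) (mul_self_nonneg _)
  rw [bergerSasaki_apply]
  by_cases h1 : horizontalPart u ξ = 0
  · by_cases h2 : verticalPart g u ξ = 0
    · refine absurd ?_ hξ
      have hi : (baseCoords (I := I) u.proj).IsInvertible :=
        isInvertible_mfderiv_extChartAt (mem_extChartAt_source _)
      have hj : (tangentCoords u).IsInvertible :=
        isInvertible_mfderiv_extChartAt (I := I.tangent) (mem_extChartAt_source u)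
      rw [horizontalPart_eq'] at h1
      have h1' : (tangentCoords u ξ).1 = 0 := hi.inverse.injective (h1.trans (map_zero _).symm)
      rw [verticalPart_apply, h1', map_zero, add_zero] at h2
      have h2' : (tangentCoords u ξ).2 = 0 := hi.inverse.injective (h2.trans (map_zero _).symm)
      exact hj.injective ((Prod.ext h1' h2' : tangentCoords u ξ = 0).trans (map_zero _).symm)
    · have := g.pos _ _ h2
      have := nn (horizontalPart u ξ)
      linarith
  · have := g.pos _ _ h1
    have := nn (verticalPart g u ξ)
    linarith

end Lifts

end Manifolds

end

end BergerSasaki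

namespace BergerSasaki

noncomputable section

/-! ### Levi-Civita calculus on a coordinate space and the local Berger–Sasaki metric. -/

section LocalComputations

variable {E : Type*} [NormedAddCommGroup E] [NormedSpace ℝ E]

/-! In the charts of `TM` induced by those of `M`, the projection is `Prod.fst`. Its second
fundamental form at `(y, w)` is therefore `Γʰ(u.1, v.1)` minus the base component of the Christoffel
map of `g_BS`, and everything rests on computing that component.

Pair the Christoffel map of `g_BS` with the horizontal lift of `c` and apply the Koszul formula.
Since `g` and `φ` are parallel, the derivatives of the Berger form `B` cancel along horizontal
directions, and only a curvature contribution survives (`inner_christoffelL_localBergerSasaki`): `2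
g(Γ_BS(u, v).1, c) = 2 g(Γ(u.1, v.1), c) + B(Vv, R(u.1, c)w) + B(Vu, R(v.1, c)w)`, where `V` is the
vertical part.

If `R = 0`, the base component is `Γ(u.1, v.1)`, so the projection and the identity have the same
condition `Γʰ = Γ`. Conversely, suppose that the base component is a bilinear function of `u.1` and
`v.1`. Two horizontal vectors give `Γʰ = Γ`. A horizontal lift of `a` and the vertical vector `R(a,
c)w` give `B(R(a, c)w, R(a, c)w) = 0`, hence `R(a, c)w = 0` by positivity of `B`.

The remaining work identifies the invariantly defined metric on `TM` with its coordinate expression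
near each chart centre (`chartForm_bergerSasaki`). This relies on the transformation law of
Christoffel maps. -/

theorem isInvertible_of_pos [FiniteDimensional ℝ E] (A : E →L[ℝ] E →L[ℝ] ℝ)
    (hA : ∀ v, v ≠ 0 → 0 < A v v) : A.IsInvertible := by
  have hinj : Function.Injective (A : E →ₗ[ℝ] E →L[ℝ] ℝ) := by
    rw [injective_iff_map_eq_zero]
    intro v hv
    by_contra h
    have h1 := hA v h
    have h2 : A v = 0 := hv
    simp [h2] at h1
  have hdim : finrank ℝ E = finrank ℝ (E →L[ℝ] ℝ) := by
    rw [← (LinearMap.toContinuousLinearMap (𝕜 := ℝ) (E := E) (F' := ℝ)).finrank_eq]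
    exact (Subspace.dual_finrank_eq (K := ℝ) (V := E)).symm
  refine ⟨(LinearEquiv.ofInjectiveOfFinrankEq _ hinj hdim).toContinuousLinearEquiv, ?_⟩
  ext v w
  rfl

/-- The Christoffel map, as a bilinear map depending on the base point. -/
def christoffelL (g : E → E →L[ℝ] E →L[ℝ] ℝ) (y : E) : E →L[ℝ] E →L[ℝ] E :=
  (ContinuousLinearMap.compL ℝ E (E →L[ℝ] ℝ) E (g y).inverse).comp ((2⁻¹ : ℝ) •
    (fderiv ℝ g y + (fderiv ℝ g y).flip -
      (ContinuousLinearMap.flipₗᵢ ℝ E E ℝ : (E →L[ℝ] E →L[ℝ] ℝ) →L[ℝ] _).comp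
        (fderiv ℝ g y).flip))

theorem christoffelL_apply (g : E → E →L[ℝ] E →L[ℝ] ℝ) (y u : E) :
    christoffelL g y u = christoffel g y u := rfl

/-- Near `y`, the field `g` of bilinear forms is a smooth metric. -/
structure IsMetricAt (g : E → E →L[ℝ] E →L[ℝ] ℝ) (y : E) : Prop where
  contDiffAt : ContDiffAt ℝ ∞ g y
  symm : ∀ᶠ z in nhds y, ∀ u v, g z u v = g z v u
  pos : ∀ v, v ≠ 0 → 0 < g y v v

namespace IsMetricAt

variable [FiniteDimensional ℝ E] {g : E → E →L[ℝ] E →L[ℝ] ℝ} {y : E}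

omit [FiniteDimensional ℝ E] in
theorem differentiableAt (hg : IsMetricAt g y) : DifferentiableAt ℝ g y :=
  hg.contDiffAt.differentiableAt (by simp)

theorem isInvertible (hg : IsMetricAt g y) : (g y).IsInvertible := isInvertible_of_pos _ hg.pos

theorem eq_of_inner (hg : IsMetricAt g y) {u v : E} (h : ∀ w, g y u w = g y v w) : u = v :=
  hg.isInvertible.injective (ContinuousLinearMap.ext h)

theorem contDiffAt_christoffelL (hg : IsMetricAt g y) : ContDiffAt ℝ ∞ (christoffelL g) y := by
  have : CompleteSpace E := FiniteDimensional.complete ℝ E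
  have h1 : ContDiffAt ℝ ∞ (fun z ↦ (g z).inverse) y :=
    (hg.isInvertible.contDiffAt_map_inverse (n := ∞)).comp y hg.contDiffAt
  have h2 : ContDiffAt ℝ ∞ (fderiv ℝ g) y := hg.contDiffAt.fderiv_right (by simp)
  have h3 : ContDiffAt ℝ ∞ (fun z ↦ (fderiv ℝ g z).flip) y :=
    (ContinuousLinearMap.flipₗᵢ ℝ E E (E →L[ℝ] ℝ)).contDiff.contDiffAt.comp y h2
  unfold christoffelL
  have h4 : ContDiffAt ℝ ∞ (fun z ↦
      (ContinuousLinearMap.flipₗᵢ ℝ E E ℝ : (E →L[ℝ] E →L[ℝ] ℝ) →L[ℝ] E →L[ℝ] E →L[ℝ] ℝ).comp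
        (fderiv ℝ g z).flip) y := contDiffAt_const.clm_comp h3
  have h5 : ContDiffAt ℝ ∞ (fun z ↦ ContinuousLinearMap.compL ℝ E (E →L[ℝ] ℝ) E (g z).inverse) y :=
    (ContinuousLinearMap.compL ℝ E (E →L[ℝ] ℝ) E).contDiff.contDiffAt.comp y h1
  exact h5.clm_comp (((h2.add h3).sub h4).const_smul (2⁻¹ : ℝ))

omit [FiniteDimensional ℝ E] in
theorem fderiv_apply (hg : IsMetricAt g y) (u v w : E) :
    fderiv ℝ g y u v w = fderiv ℝ (fun z ↦ g z v w) y u := by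
  have h1 : HasFDerivAt g (fderiv ℝ g y) y := hg.differentiableAt.hasFDerivAt
  have h2 := (h1.clm_apply (hasFDerivAt_const v y)).clm_apply (hasFDerivAt_const w y)
  rw [h2.fderiv]
  simp

-- Symmetry has to hold on a neighbourhood in order to be differentiated; this is why
-- `IsMetricAt.symm` is an eventual statement while `pos` concerns one point.
omit [FiniteDimensional ℝ E] in
theorem fderiv_symm (hg : IsMetricAt g y) (u v w : E) :
    fderiv ℝ g y u v w = fderiv ℝ g y u w v := by
  rw [hg.fderiv_apply, hg.fderiv_apply]
  congr 1
  apply Filter.EventuallyEq.fderiv_eq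
  filter_upwards [hg.symm] with z hz using hz v w

theorem inner_christoffelL (hg : IsMetricAt g y) (u v w : E) :
    g y (christoffelL g y u v) w =
      2⁻¹ * (fderiv ℝ g y u v w + fderiv ℝ g y v u w - fderiv ℝ g y w u v) :=
  christoffel_spec g y u v w hg.isInvertible

/-- Torsion-freeness: exchanging `u` and `v` permutes the first two Koszul terms and fixes the
third. -/
theorem christoffelL_symm (hg : IsMetricAt g y) (u v : E) :
    christoffelL g y u v = christoffelL g y v u := by
  refine hg.eq_of_inner fun w ↦ ?_
  rw [hg.inner_christoffelL, hg.inner_christoffelL, hg.fderiv_symm w u v]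
  ring

/-- The metric is parallel for its Levi-Civita connection. -/
theorem fderiv_eq (hg : IsMetricAt g y) (u v w : E) :
    fderiv ℝ g y u v w = g y (christoffelL g y u v) w + g y v (christoffelL g y u w) := by
  rw [hg.symm.self_of_nhds v, hg.inner_christoffelL, hg.inner_christoffelL, hg.fderiv_symm u w v,
    hg.fderiv_symm v u w, hg.fderiv_symm w u v]
  ring

end IsMetricAt

variable [FiniteDimensional ℝ E]

/-- The transformation law of the Christoffel map under a change of coordinates `τ`. -/
theorem christoffelL_pullback {g g' : E → E →L[ℝ] E →L[ℝ] ℝ} {τ : E → E} {y : E}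
    (hg : IsMetricAt g y) (hg' : IsMetricAt g' (τ y)) (hτ : ContDiffAt ℝ ∞ τ y)
    (h : ∀ᶠ z in nhds y, ∀ u v, g z u v = g' (τ z) (fderiv ℝ τ z u) (fderiv ℝ τ z v))
    (hs : Function.Surjective (fderiv ℝ τ y)) (u v : E) :
    fderiv ℝ τ y (christoffelL g y u v) =
      fderiv ℝ (fderiv ℝ τ) y u v + christoffelL g' (τ y) (fderiv ℝ τ y u) (fderiv ℝ τ y v) := by
  have hsymm := hg'.symm.self_of_nhds
  have hτ1 : HasFDerivAt τ (fderiv ℝ τ y) y := (hτ.differentiableAt (by simp)).hasFDerivAt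
  have hτ2 : HasFDerivAt (fderiv ℝ τ) (fderiv ℝ (fderiv ℝ τ) y) y :=
    ((hτ.fderiv_right (m := ∞) (by simp)).differentiableAt (by simp)).hasFDerivAt
  have hD (a b c : E) : fderiv ℝ g y a b c =
      fderiv ℝ g' (τ y) (fderiv ℝ τ y a) (fderiv ℝ τ y b) (fderiv ℝ τ y c) +
      g' (τ y) (fderiv ℝ (fderiv ℝ τ) y a b) (fderiv ℝ τ y c) +
      g' (τ y) (fderiv ℝ τ y b) (fderiv ℝ (fderiv ℝ τ) y a c) := by
    rw [hg.fderiv_apply]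
    have h0 : (fun z ↦ g z b c) =ᶠ[nhds y]
        fun z ↦ g' (τ z) (fderiv ℝ τ z b) (fderiv ℝ τ z c) := by
      filter_upwards [h] with z hz using hz b c
    rw [h0.fderiv_eq]
    have h1 : HasFDerivAt (fun z ↦ g' (τ z)) ((fderiv ℝ g' (τ y)).comp (fderiv ℝ τ y)) y :=
      hg'.differentiableAt.hasFDerivAt.comp y hτ1
    have h2 := (h1.clm_apply (hτ2.clm_apply (hasFDerivAt_const b y))).clm_apply
      (hτ2.clm_apply (hasFDerivAt_const c y))
    rw [h2.fderiv]
    simp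
    ring
  have hsym2 (a b : E) : fderiv ℝ (fderiv ℝ τ) y a b = fderiv ℝ (fderiv ℝ τ) y b a :=
    (hτ.isSymmSndFDerivAt (by simpa using ENat.LEInfty.out)) a b
  refine hg'.eq_of_inner fun w ↦ ?_
  -- By surjectivity every test vector is some `dτ w`, so the Koszul formulas of `g` and `g'` can be
  -- compared. Of the six terms in `D²τ`, symmetry cancels four and leaves twice `g'(D²τ(u, v), dτ
  -- w)`.
  obtain ⟨w, rfl⟩ := hs w
  rw [← h.self_of_nhds, hg.inner_christoffelL, hD, hD, hD, map_add, add_apply,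
    hg'.inner_christoffelL, hsym2 v u, hsym2 w u, hsym2 w v,
    hsymm (fderiv ℝ (fderiv ℝ τ) y u w),
    hsymm (fderiv ℝ τ y u) (fderiv ℝ (fderiv ℝ τ) y v w)]
  ring

-- A map that is linear in coordinates has no second derivative, so its second fundamental form only
-- compares Christoffel maps. The same holds below for `Prod.fst`.
omit [FiniteDimensional ℝ E] in
theorem secondFundamentalForm_of_eventuallyEq_id {g g' : E → E →L[ℝ] E →L[ℝ] ℝ} {f : E → E} {y : E}
    (hf : f =ᶠ[nhds y] id) (u v : E) :
    secondFundamentalForm g g' f y u v = christoffelL g' y u v - christoffelL g y u v := by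
  have h1 : fderiv ℝ f =ᶠ[nhds y] fun _ ↦ ContinuousLinearMap.id ℝ E := by
    filter_upwards [hf.fderiv (𝕜 := ℝ)] with z hz
    rw [hz, show (id : E → E) = fun x ↦ x from rfl, fderiv_fun_id]
  rw [secondFundamentalForm, h1.fderiv_eq, h1.self_of_nhds, hf.self_of_nhds]
  simp [christoffelL_apply]
  abel

omit [FiniteDimensional ℝ E] in
theorem secondFundamentalForm_of_eventuallyEq_fst {G : E × E → E × E →L[ℝ] E × E →L[ℝ] ℝ}
    {g' : E → E →L[ℝ] E →L[ℝ] ℝ} {f : E × E → E} {p : E × E}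
    (hf : f =ᶠ[nhds p] Prod.fst) (u v : E × E) :
    secondFundamentalForm G g' f p u v =
      christoffelL g' p.1 u.1 v.1 - (christoffelL G p u v).1 := by
  have h1 : fderiv ℝ f =ᶠ[nhds p] fun _ ↦ ContinuousLinearMap.fst ℝ E E := by
    filter_upwards [hf.fderiv (𝕜 := ℝ)] with z hz
    rw [hz, fderiv_fst (𝕜 := ℝ)]
  rw [secondFundamentalForm, h1.fderiv_eq, h1.self_of_nhds, hf.self_of_nhds]
  simp [christoffelL_apply]
  abel

/-- The vertical part of a tangent vector at `p = (y, w)`, in coordinates. -/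
def localVerticalPart (g : E → E →L[ℝ] E →L[ℝ] ℝ) (p : E × E) : E × E →L[ℝ] E :=
  ContinuousLinearMap.snd ℝ E E + (christoffelL g p.1 p.2).comp (ContinuousLinearMap.fst ℝ E E)

/-- The form `g + δ² g(·, Φw) g(·, Φw)` at `p = (y, w)`, in coordinates. -/
def localBergerForm (g : E → E →L[ℝ] E →L[ℝ] ℝ) (Φ : E → E →L[ℝ] E) (δ : ℝ) (p : E × E) :
    E →L[ℝ] E →L[ℝ] ℝ :=
  g p.1 + δ ^ 2 • (g p.1 (Φ p.1 p.2)).smulRight (g p.1 (Φ p.1 p.2))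

/-- The Berger type deformed Sasaki metric in coordinates. -/
def localBergerSasaki (g : E → E →L[ℝ] E →L[ℝ] ℝ) (Φ : E → E →L[ℝ] E) (δ : ℝ) (p : E × E) :
    E × E →L[ℝ] E × E →L[ℝ] ℝ :=
  (g p.1).bilinearComp (ContinuousLinearMap.fst ℝ E E) (ContinuousLinearMap.fst ℝ E E) +
    (localBergerForm g Φ δ p).bilinearComp (localVerticalPart g p) (localVerticalPart g p)

-- Pulling back both arguments is precompose, flip, precompose, flip, and flips are continuous
-- linear.
omit [FiniteDimensional ℝ E] in
theorem _root_.ContDiffAt.clm_bilinearComp {D F : Type*} [NormedAddCommGroup D] [NormedSpace ℝ D]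
    [NormedAddCommGroup F] [NormedSpace ℝ F]
    {B : D → E →L[ℝ] E →L[ℝ] ℝ} {L L' : D → F →L[ℝ] E} {x : D} (hB : ContDiffAt ℝ ∞ B x)
    (hL : ContDiffAt ℝ ∞ L x) (hL' : ContDiffAt ℝ ∞ L' x) :
    ContDiffAt ℝ ∞ (fun z ↦ (B z).bilinearComp (L z) (L' z)) x := by
  have h1 := (ContinuousLinearMap.flipₗᵢ ℝ F E ℝ).contDiff.contDiffAt.comp x (hB.clm_comp hL)
  exact (ContinuousLinearMap.flipₗᵢ ℝ F F ℝ).contDiff.contDiffAt.comp x (h1.clm_comp hL')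

variable {g : E → E →L[ℝ] E →L[ℝ] ℝ} {Φ : E → E →L[ℝ] E} {δ : ℝ} {p : E × E}

omit [FiniteDimensional ℝ E] in
theorem localBergerForm_pos (hg : IsMetricAt g p.1) (v : E) (hv : v ≠ 0) :
    0 < localBergerForm g Φ δ p v v := by
  have h1 := hg.pos v hv
  have h2 : 0 ≤ δ ^ 2 * (g p.1 (Φ p.1 p.2) v * g p.1 (Φ p.1 p.2) v) :=
    mul_nonneg (sq_nonneg _) (mul_self_nonneg _)
  have h3 : localBergerForm g Φ δ p v v =
    g p.1 v v + δ ^ 2 * (g p.1 (Φ p.1 p.2) v * g p.1 (Φ p.1 p.2) v) := by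
    simp [localBergerForm]
  linarith

theorem contDiffAt_localVerticalPart (hg : IsMetricAt g p.1) :
    ContDiffAt ℝ ∞ (localVerticalPart g) p := by
  have h1 : ContDiffAt ℝ ∞ (fun q : E × E ↦ christoffelL g q.1) p :=
    hg.contDiffAt_christoffelL.comp p contDiffAt_fst
  have h2 : ContDiffAt ℝ ∞ (fun q : E × E ↦ christoffelL g q.1 q.2) p :=
    h1.clm_apply contDiffAt_snd
  have h3 : ContDiffAt ℝ ∞ (fun q : E × E ↦
      (christoffelL g q.1 q.2).comp (ContinuousLinearMap.fst ℝ E E)) p :=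
    h2.clm_comp contDiffAt_const
  exact contDiffAt_const.add h3

omit [FiniteDimensional ℝ E] in
theorem contDiffAt_localBergerForm (hg : IsMetricAt g p.1) (hΦ : ContDiffAt ℝ ∞ Φ p.1) :
    ContDiffAt ℝ ∞ (localBergerForm g Φ δ) p := by
  have h1 : ContDiffAt ℝ ∞ (fun q : E × E ↦ g q.1) p := hg.contDiffAt.comp p contDiffAt_fst
  have h2 : ContDiffAt ℝ ∞ (fun q : E × E ↦ Φ q.1) p := hΦ.comp p contDiffAt_fst
  have h3 : ContDiffAt ℝ ∞ (fun q : E × E ↦ Φ q.1 q.2) p := h2.clm_apply contDiffAt_snd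
  have h4 : ContDiffAt ℝ ∞ (fun q : E × E ↦ g q.1 (Φ q.1 q.2)) p := h1.clm_apply h3
  exact h1.add ((h4.smulRight h4).const_smul (δ ^ 2))

omit [FiniteDimensional ℝ E] in
theorem localBergerSasaki_apply (u v : E × E) :
    localBergerSasaki g Φ δ p u v = g p.1 u.1 v.1 +
      localBergerForm g Φ δ p (localVerticalPart g p u) (localVerticalPart g p v) := rfl

omit [FiniteDimensional ℝ E] in
theorem localBergerForm_apply (u v : E) :
    localBergerForm g Φ δ p u v =
      g p.1 u v + δ ^ 2 * (g p.1 (Φ p.1 p.2) u * g p.1 (Φ p.1 p.2) v) := rfl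

/-- For positivity: `v.1` and the vertical part of `v` are related to `v` by a triangular change of
variables, so they vanish together only when `v = 0`. -/
theorem isMetricAt_localBergerSasaki (hg : IsMetricAt g p.1) (hΦ : ContDiffAt ℝ ∞ Φ p.1) :
    IsMetricAt (localBergerSasaki g Φ δ) p where
  contDiffAt := by
    have h1 : ContDiffAt ℝ ∞ (fun q : E × E ↦ g q.1) p := hg.contDiffAt.comp p contDiffAt_fst
    have h2 := contDiffAt_localVerticalPart hg
    exact (h1.clm_bilinearComp contDiffAt_const contDiffAt_const).add
      ((contDiffAt_localBergerForm hg hΦ).clm_bilinearComp h2 h2)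
  symm := by
    have h : ∀ᶠ q : E × E in nhds p, ∀ u v, g q.1 u v = g q.1 v u :=
      continuousAt_fst.eventually hg.symm
    filter_upwards [h] with q hq u v
    rw [localBergerSasaki_apply, localBergerSasaki_apply, localBergerForm_apply,
      localBergerForm_apply, hq u.1 v.1, hq (localVerticalPart g q u) (localVerticalPart g q v)]
    ring
  pos v hv := by
    rw [localBergerSasaki_apply]
    by_cases h1 : v.1 = 0
    · have h2 : v.2 ≠ 0 := fun h ↦ hv (Prod.ext h1 h)
      have h3 : localVerticalPart g p v = v.2 := by simp [localVerticalPart, h1]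
      rw [h1, h3]
      simpa using localBergerForm_pos hg v.2 h2
    · have h2 := hg.pos v.1 h1
      by_cases h3 : localVerticalPart g p v = 0
      · simpa [h3] using h2
      · exact add_pos h2 (localBergerForm_pos hg _ h3)

/-- The product rule. Along `u`, `g'` is the derivative of `g`, `ν` that of `Γ(w)` and `q'` that of
`q = Φw`, where `w = p.2`. They enter through equations so that a simplified expression can be
supplied, as is done for `q'` in the horizontal direction. -/
theorem fderiv_localBergerSasaki (hg : IsMetricAt g p.1) (hΦ : ContDiffAt ℝ ∞ Φ p.1)
    (u v w : E × E) (g' : E →L[ℝ] E →L[ℝ] ℝ) (hg' : g' = fderiv ℝ g p.1 u.1)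
    (ν : E →L[ℝ] E) (hν : ν = fderiv ℝ (christoffelL g) p.1 u.1 p.2 + christoffelL g p.1 u.2)
    (q q' β β' : E) (hq : q = Φ p.1 p.2) (hq' : q' = fderiv ℝ Φ p.1 u.1 p.2 + Φ p.1 u.2)
    (hβ : β = localVerticalPart g p v) (hβ' : β' = localVerticalPart g p w) :
    fderiv ℝ (localBergerSasaki g Φ δ) p u v w =
      g' v.1 w.1 + (g' β β' + g p.1 (ν v.1) β' + g p.1 β (ν w.1)) +
      δ ^ 2 * ((g' q β + g p.1 q' β + g p.1 q (ν v.1)) * g p.1 q β' +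
        g p.1 q β * (g' q β' + g p.1 q' β' + g p.1 q (ν w.1))) := by
  rw [(isMetricAt_localBergerSasaki hg hΦ).fderiv_apply]
  have d1 : HasFDerivAt (fun z : E × E ↦ g z.1) _ p :=
    hg.differentiableAt.hasFDerivAt.comp p hasFDerivAt_fst
  have d2 : HasFDerivAt (fun z : E × E ↦ Φ z.1) _ p :=
    (hΦ.differentiableAt (by simp)).hasFDerivAt.comp p hasFDerivAt_fst
  have d3 : HasFDerivAt (fun z : E × E ↦ christoffelL g z.1) _ p :=
    (hg.contDiffAt_christoffelL.differentiableAt (by simp)).hasFDerivAt.comp p hasFDerivAt_fst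
  have dq := d2.clm_apply (hasFDerivAt_snd (p := p))
  -- `b + Γ(w)a` is the vertical part of the constant vector `(a, b)`, and `dgq` differentiates its
  -- pairing with `Φw`.
  have dn (a b : E) := ((d3.clm_apply (hasFDerivAt_snd (p := p))).clm_apply
    (hasFDerivAt_const a p)).const_add b
  have dgq (a b : E) := (d1.clm_apply dq).clm_apply (dn a b)
  have e1 := (d1.clm_apply (hasFDerivAt_const v.1 p)).clm_apply (hasFDerivAt_const w.1 p)
  have e2 := (d1.clm_apply (dn v.1 v.2)).clm_apply (dn w.1 w.2)
  have e := e1.add (e2.add (((dgq v.1 v.2).mul (dgq w.1 w.2)).const_mul (δ ^ 2)))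
  refine (congrArg (fun L : E × E →L[ℝ] ℝ ↦ L u) (e.fderiv :
    fderiv ℝ (fun z ↦ localBergerSasaki g Φ δ z v w) p = _)).trans ?_
  subst hg' hν hq hq' hβ hβ'
  simp [localVerticalPart]
  ring

/-- Symmetry of `Γ` near the point moves `w` into the first slot, where the fibre coordinate stands
in the derivatives of `g_BS`. -/
theorem curvature_eq (hg : ∀ᶠ z in nhds p.1, IsMetricAt g z) (a c w : E) :
    curvature g p.1 a c w = fderiv ℝ (christoffelL g) p.1 a w c
      - fderiv ℝ (christoffelL g) p.1 c w a
      + christoffelL g p.1 a (christoffelL g p.1 w c)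
      - christoffelL g p.1 c (christoffelL g p.1 w a) := by
  have h (b d : E) : fderiv ℝ (fun z ↦ christoffel g z b w) p.1 d =
      fderiv ℝ (christoffelL g) p.1 d w b := by
    have h1 : (fun z ↦ christoffel g z b w) =ᶠ[nhds p.1] fun z ↦ christoffelL g z w b := by
      filter_upwards [hg] with z hz
      rw [← christoffelL_apply, hz.christoffelL_symm]
    have h2 : HasFDerivAt (christoffelL g) _ p.1 :=
      (hg.self_of_nhds.contDiffAt_christoffelL.differentiableAt (by simp)).hasFDerivAt
    rw [h1.fderiv_eq, ((h2.clm_apply (hasFDerivAt_const w p.1)).clm_apply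
      (hasFDerivAt_const b p.1)).fderiv]
    simp
  rw [curvature, h, h]
  simp only [← christoffelL_apply, hg.self_of_nhds.christoffelL_symm c w,
    hg.self_of_nhds.christoffelL_symm a w]

/-- The horizontal part of the Christoffel map of the Berger type deformed Sasaki metric. -/
theorem inner_christoffelL_localBergerSasaki (hg : ∀ᶠ z in nhds p.1, IsMetricAt g z)
    (hΦ : ContDiffAt ℝ ∞ Φ p.1) (hpar : ∀ u w, covDerivEndo g Φ p.1 u w = 0) (u v : E × E) (c : E) :
    2 * g p.1 ((christoffelL (localBergerSasaki g Φ δ) p u v).1) c =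
      2 * g p.1 (christoffelL g p.1 u.1 v.1) c +
      localBergerForm g Φ δ p (localVerticalPart g p v) (curvature g p.1 u.1 c p.2) +
      localBergerForm g Φ δ p (localVerticalPart g p u) (curvature g p.1 v.1 c p.2) := by
  have hg0 := hg.self_of_nhds
  have hs := hg0.symm.self_of_nhds
  -- The test vector is the horizontal lift of `c`; pairing with it isolates the base component, so
  -- the fibre component of the Christoffel map is never needed.
  have hC0 : localVerticalPart g p (c, - christoffelL g p.1 p.2 c) = 0 := by
    simp [localVerticalPart]
  have h0 : localBergerSasaki g Φ δ p (christoffelL (localBergerSasaki g Φ δ) p u v)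
      (c, - christoffelL g p.1 p.2 c) =
      g p.1 ((christoffelL (localBergerSasaki g Φ δ) p u v).1) c := by
    rw [localBergerSasaki_apply, hC0, map_zero, add_zero]
  -- This is where `∇Φ = 0` enters: along the horizontal lift of `c`, the derivative of `Φw` is that
  -- of a parallel vector.
  have hq : - christoffelL g p.1 c (Φ p.1 p.2) =
      fderiv ℝ Φ p.1 c p.2 + Φ p.1 (-christoffelL g p.1 p.2 c) := by
    have := hpar c p.2
    rw [covDerivEndo, ← christoffelL_apply, hg0.christoffelL_symm c p.2] at this
    rw [← sub_eq_zero, ← neg_eq_zero, ← this, map_neg]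
    abel
  -- Trading fibre components for vertical parts leaves only horizontal and vertical data in the
  -- Koszul formula.
  have hu : u.2 = localVerticalPart g p u - christoffelL g p.1 p.2 u.1 := by
    simp [localVerticalPart]
  have hv : v.2 = localVerticalPart g p v - christoffelL g p.1 p.2 v.1 := by
    simp [localVerticalPart]
  have hcs := hg0.christoffelL_symm
  rw [← h0, (isMetricAt_localBergerSasaki hg0 hΦ).inner_christoffelL,
    fderiv_localBergerSasaki hg0 hΦ u v _ _ rfl _ rfl _ _ _ _ rfl rfl rfl rfl,
    fderiv_localBergerSasaki hg0 hΦ v u _ _ rfl _ rfl _ _ _ _ rfl rfl rfl rfl,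
    fderiv_localBergerSasaki hg0 hΦ (c, - christoffelL g p.1 p.2 c) u v _ rfl _ rfl _ _ _ _ rfl hq
      rfl rfl, curvature_eq hg, curvature_eq hg, hC0, hu, hv]
  generalize localVerticalPart g p u = β
  generalize localVerticalPart g p v = β'
  generalize u.1 = a
  generalize v.1 = a'
  -- Metric compatibility removes all derivatives of `g`. What remains is a polynomial identity,
  -- once symmetric pairs of arguments are put in a common order.
  rw [hg0.fderiv_eq a a' c, hg0.fderiv_eq a' a c, hg0.fderiv_eq c a a', hg0.fderiv_eq c β β',
    hg0.fderiv_eq c _ β, hg0.fderiv_eq c _ β']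
  simp only [localBergerForm_apply, map_zero, map_neg, map_add, map_sub, add_apply, sub_apply,
    neg_apply]
  rw [hcs β c, hcs β' c, hcs (christoffelL g p.1 p.2 a) c, hcs (christoffelL g p.1 p.2 a') c,
    hcs (christoffelL g p.1 p.2 c) a, hcs (christoffelL g p.1 p.2 c) a', hcs a' a, hcs a c, hcs a' c,
    hs (christoffelL g p.1 c a) a', hs (christoffelL g p.1 c β) β',
    hs (fderiv ℝ (christoffelL g) p.1 c p.2 a) β',
    hs (christoffelL g p.1 a (christoffelL g p.1 p.2 c)) β']
  ring

end LocalComputations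

/-! ### Charts of the manifold and of its tangent bundle, and their transition maps. -/

section Charts

variable {E : Type*} [NormedAddCommGroup E] [NormedSpace ℝ E]
  {H : Type*} [TopologicalSpace H] {I : ModelWithCorners ℝ E H} [I.Boundaryless]
  {M : Type*} [TopologicalSpace M] [ChartedSpace H M] [IsManifold I ∞ M]

theorem contDiffAt_transition {x x' : M} {y : E} (hy : y ∈ (extChartAt I x).target)
    (hx' : (extChartAt I x).symm y ∈ (extChartAt I x').source) :
    ContDiffAt ℝ ∞ (extChartAt I x' ∘ (extChartAt I x).symm) y := by
  have h := contDiffWithinAt_ext_coord_change (I := I) (n := ∞) x' x (y := y)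
    (by rw [PartialEquiv.trans_source]; exact ⟨hy, hx'⟩)
  rwa [I.range_eq_univ, contDiffWithinAt_univ] at h

theorem mdifferentiableAt_extChartAt_symm {x : M} {y : E} (hy : y ∈ (extChartAt I x).target) :
    MDifferentiableAt 𝓘(ℝ, E) I (extChartAt I x).symm y := by
  have := mdifferentiableWithinAt_extChartAt_symm hy
  rwa [I.range_eq_univ, mdifferentiableWithinAt_univ] at this

omit [I.Boundaryless] in
theorem mdifferentiableAt_extChartAt' {x p : M} (hp : p ∈ (extChartAt I x).source) :
    MDifferentiableAt I 𝓘(ℝ, E) (extChartAt I x) p :=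
  mdifferentiableAt_extChartAt (by rwa [← extChartAt_source I])

/-- The tangent space at a point is identified with `E` by the preferred chart there, so the
derivative of an inverse chart is that of the transition to the chart at the image point. -/
theorem mfderiv_extChartAt_symm_eq {x : M} {y : E} (hy : y ∈ (extChartAt I x).target) :
    (mfderiv 𝓘(ℝ, E) I (extChartAt I x).symm y : E →L[ℝ] E) =
      fderiv ℝ (extChartAt I ((extChartAt I x).symm y) ∘ (extChartAt I x).symm) y := by
  rw [(mdifferentiableAt_extChartAt_symm hy).mfderiv]
  simp [writtenInExtChartAt, Function.comp_def]
  rfl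

theorem mfderiv_extChartAt_symm_apply {x x' : M} {y : E} (hy : y ∈ (extChartAt I x).target)
    (hx' : (extChartAt I x).symm y ∈ (extChartAt I x').source) (v : E) :
    (mfderiv I 𝓘(ℝ, E) (extChartAt I x') ((extChartAt I x).symm y)
      (mfderiv 𝓘(ℝ, E) I (extChartAt I x).symm y v) : E) =
      fderiv ℝ (extChartAt I x' ∘ (extChartAt I x).symm) y v := by
  have h := mfderiv_comp y (mdifferentiableAt_extChartAt' hx')
    (mdifferentiableAt_extChartAt_symm hy)
  rw [mfderiv_eq_fderiv] at h
  exact (congrArg (fun L : E →L[ℝ] E ↦ L v) h).symm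

theorem mfderiv_symm_mfderiv_extChartAt {x : M} {y : E} (hy : y ∈ (extChartAt I x).target)
    (v : TangentSpace I ((extChartAt I x).symm y)) :
    mfderiv 𝓘(ℝ, E) I (extChartAt I x).symm y
      (mfderiv I 𝓘(ℝ, E) (extChartAt I x) ((extChartAt I x).symm y) v) = v := by
  have h := mfderivWithin_extChartAt_symm_comp_mfderiv_extChartAt hy
  rw [I.range_eq_univ, mfderivWithin_univ] at h
  exact congrArg (fun L : E →L[ℝ] E ↦ L v) h

theorem surjective_mfderiv_extChartAt_symm {x : M} {y : E} (hy : y ∈ (extChartAt I x).target) :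
    Function.Surjective (mfderiv 𝓘(ℝ, E) I (extChartAt I x).symm y) :=
  fun v ↦ ⟨_, mfderiv_symm_mfderiv_extChartAt hy v⟩

theorem injective_mfderiv_extChartAt_symm {x : M} {y : E} (hy : y ∈ (extChartAt I x).target) :
    Function.Injective (mfderiv 𝓘(ℝ, E) I (extChartAt I x).symm y) := by
  have h := mfderiv_extChartAt_comp_mfderivWithin_extChartAt_symm hy
  rw [I.range_eq_univ, mfderivWithin_univ] at h
  intro v w hvw
  have h' (a : E) := congrArg (fun L : E →L[ℝ] E ↦ L a) h
  rw [← show _ = v from h' v, ← show _ = w from h' w]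
  exact congrArg (mfderiv I 𝓘(ℝ, E) (extChartAt I x) ((extChartAt I x).symm y)) hvw

omit [I.Boundaryless] in
/-- A chart of the tangent bundle, in terms of the derivative of the chart of the base. -/
theorem extChartAt_tangent_apply (u : TangentBundle I M) {p : M}
    (hp : p ∈ (extChartAt I u.proj).source) (v : TangentSpace I p) :
    extChartAt I.tangent u ⟨p, v⟩ =
      (extChartAt I u.proj p, mfderiv I 𝓘(ℝ, E) (extChartAt I u.proj) p v) := by
  rw [extChartAt_source] at hp
  rw [← TangentBundle.continuousLinearMapAt_trivializationAt hp,
    TangentBundle.continuousLinearMapAt_trivializationAt_eq_core hp]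
  rfl

theorem extChartAt_tangent_symm_apply (u : TangentBundle I M) {y : E}
    (hy : y ∈ (extChartAt I u.proj).target) (w : E) :
    (extChartAt I.tangent u).symm (y, w) =
      ⟨(extChartAt I u.proj).symm y, mfderiv 𝓘(ℝ, E) I (extChartAt I u.proj).symm y w⟩ := by
  have hp : (extChartAt I u.proj).symm y ∈ (chartAt H u.proj).source := by
    rw [← extChartAt_source I]
    exact (extChartAt I u.proj).map_target hy
  have h := TangentBundle.symmL_trivializationAt (I := I) hp
  rw [I.range_eq_univ, mfderivWithin_univ, (extChartAt I u.proj).right_inv hy,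
    TangentBundle.symmL_trivializationAt_eq_core hp] at h
  rw [← h]
  rfl

omit [I.Boundaryless] in
theorem mem_extChartAt_tangent_target (u : TangentBundle I M) {y : E}
    (hy : y ∈ (extChartAt I u.proj).target) (w : E) : (y, w) ∈ (extChartAt I.tangent u).target := by
  have h := FiberBundle.extChartAt_target (IB := I) (F := E) (E := (TangentSpace I : M → Type _)) u
  have : (y, w) ∈ ((extChartAt I u.proj).target ∩ (extChartAt I u.proj).symm ⁻¹'
      (trivializationAt E (TangentSpace I) u.proj).baseSet) ×ˢ (Set.univ : Set E) := by
    refine ⟨⟨hy, ?_⟩, trivial⟩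
    have := (extChartAt I u.proj).map_target hy
    simpa using this
  rwa [← h] at this

theorem contMDiffAt_extChartAt_symm' {x : M} {y : E} (hy : y ∈ (extChartAt I x).target) :
    ContMDiffAt 𝓘(ℝ, E) I ∞ (extChartAt I x).symm y :=
  (contMDiffOn_extChartAt_symm x).contMDiffAt ((isOpen_extChartAt_target x).mem_nhds hy)

/-- The coordinate vector fields of a chart are smooth. -/
theorem contMDiffAt_coordinateField {x : M} {y : E} (hy : y ∈ (extChartAt I x).target) (a : E) :
    ContMDiffAt 𝓘(ℝ, E) I.tangent ∞ (fun z ↦ TotalSpace.mk' E (E := (TangentSpace I : M → Type _))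
      ((extChartAt I x).symm z) (mfderiv 𝓘(ℝ, E) I (extChartAt I x).symm z a)) y := by
  -- With its fibre coordinate frozen at `a`, the inverse chart of `TM` is the coordinate field;
  -- only the base point of `⟨x, 0⟩` matters.
  have h1 : ContMDiffAt 𝓘(ℝ, E × E) I.tangent ∞
      (extChartAt I.tangent (⟨x, 0⟩ : TangentBundle I M)).symm (y, a) :=
    (contMDiffOn_extChartAt_symm _).contMDiffAt
      ((isOpen_extChartAt_target _).mem_nhds (mem_extChartAt_tangent_target _ hy a))
  have h2 : ContMDiffAt 𝓘(ℝ, E) 𝓘(ℝ, E × E) ∞ (fun z : E ↦ (z, a)) y :=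
    (contDiffAt_id.prodMk contDiffAt_const).contMDiffAt
  refine (h1.comp y h2).congr_of_eventuallyEq ?_
  filter_upwards [(isOpen_extChartAt_target x).mem_nhds hy] with z hz
  exact (extChartAt_tangent_symm_apply ⟨x, 0⟩ hz a).symm

omit [I.Boundaryless] [IsManifold I ∞ M] in
theorem chartForm_apply (G : ∀ x : M, TangentSpace I x →L[ℝ] TangentSpace I x →L[ℝ] ℝ) (x : M)
    (y a b : E) : chartForm I G x y a b = G ((extChartAt I x).symm y)
      (mfderiv 𝓘(ℝ, E) I (extChartAt I x).symm y a)
      (mfderiv 𝓘(ℝ, E) I (extChartAt I x).symm y b) := rfl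

/-- The coefficient is a smooth tensor evaluated on two smooth coordinate fields. -/
theorem contDiffAt_chartForm_apply (g : RiemMetric I M) {x : M} {y : E}
    (hy : y ∈ (extChartAt I x).target) (a b : E) :
    ContDiffAt ℝ ∞ (fun z ↦ chartForm I g.inner x z a b) y := by
  have h1 : ContMDiffAt 𝓘(ℝ, E) (I.prod 𝓘(ℝ, E →L[ℝ] E →L[ℝ] ℝ)) ∞
      (fun z ↦ TotalSpace.mk' (E →L[ℝ] E →L[ℝ] ℝ)
        (E := fun p : M ↦ TangentSpace I p →L[ℝ] TangentSpace I p →L[ℝ] ℝ)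
        ((extChartAt I x).symm z) (g.inner ((extChartAt I x).symm z))) y :=
    g.contMDiff.contMDiffAt.comp y (contMDiffAt_extChartAt_symm' hy)
  have h2 := ContMDiffAt.clm_bundle_apply₂ (F₁ := E) (F₂ := E) (F₃ := ℝ) (E₃ := fun _ : M ↦ ℝ) h1
    (contMDiffAt_coordinateField hy a) (contMDiffAt_coordinateField hy b)
  simp only [contMDiffAt_totalSpace] at h2
  exact h2.2.contDiffAt

theorem contDiffAt_chartEndo_apply (φ : AlmostParacomplex I M) {x : M} {y : E}
    (hy : y ∈ (extChartAt I x).target) (a : E) :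
    ContDiffAt ℝ ∞ (fun z ↦ chartEndo I φ.endo x z a) y := by
  have h1 : ContMDiffAt 𝓘(ℝ, E) (I.prod 𝓘(ℝ, E →L[ℝ] E)) ∞
      (fun z ↦ TotalSpace.mk' (E →L[ℝ] E)
        (E := fun p : M ↦ TangentSpace I p →L[ℝ] TangentSpace I p)
        ((extChartAt I x).symm z) (φ.endo ((extChartAt I x).symm z))) y :=
    φ.contMDiff.contMDiffAt.comp y (contMDiffAt_extChartAt_symm' hy)
  have h2 := ContMDiffAt.clm_bundle_apply (F₁ := E) (F₂ := E) h1
    (contMDiffAt_coordinateField hy a)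
  -- The components of the image vector field are its fibre coordinates in the chart of `TM`.
  have h3 : ContMDiffAt I.tangent 𝓘(ℝ, E × E) ∞
      (extChartAt I.tangent (⟨x, 0⟩ : TangentBundle I M)) (⟨(extChartAt I x).symm y,
        φ.endo ((extChartAt I x).symm y) (mfderiv 𝓘(ℝ, E) I (extChartAt I x).symm y a)⟩) :=
    contMDiffAt_extChartAt' (by
      rw [TangentBundle.mem_chart_source_iff, ← extChartAt_source I]
      exact (extChartAt I x).map_target hy)
  have h4 : ContDiffAt ℝ ∞ _ y := (h3.comp y h2).contDiffAt.snd
  refine h4.congr_of_eventuallyEq ?_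
  filter_upwards [(isOpen_extChartAt_target x).mem_nhds hy] with z hz
  exact (congrArg Prod.snd
    (extChartAt_tangent_apply ⟨x, 0⟩ ((extChartAt I x).map_target hz) _)).symm

variable [FiniteDimensional ℝ E]

/-- In finite dimension, smoothness of a field of linear maps can be tested on fixed vectors. -/
theorem contDiffAt_clm_of_forall_apply {D F : Type*} [NormedAddCommGroup D] [NormedSpace ℝ D]
    [NormedAddCommGroup F] [NormedSpace ℝ F] {f : D → E →L[ℝ] F} {s : Set D} (hs : IsOpen s)
    (h : ∀ z ∈ s, ∀ a, ContDiffAt ℝ ∞ (fun x ↦ f x a) z) {x : D} (hx : x ∈ s) :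
    ContDiffAt ℝ ∞ f x := by
  have : ContDiffOn ℝ ∞ f s :=
    contDiffOn_clm_apply.2 fun a z hz ↦ (h z hz a).contDiffWithinAt
  exact this.contDiffAt (hs.mem_nhds hx)

theorem contDiffAt_chartForm (g : RiemMetric I M) {x : M} {y : E}
    (hy : y ∈ (extChartAt I x).target) : ContDiffAt ℝ ∞ (chartForm I g.inner x) y := by
  refine contDiffAt_clm_of_forall_apply (isOpen_extChartAt_target x) (fun z hz a ↦ ?_) hy
  refine contDiffAt_clm_of_forall_apply (f := fun z ↦ chartForm I g.inner x z a)
    (isOpen_extChartAt_target x) (fun z hz b ↦ ?_) hz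
  exact contDiffAt_chartForm_apply g hz a b

theorem isMetricAt_chartForm (g : RiemMetric I M) {x : M} {y : E}
    (hy : y ∈ (extChartAt I x).target) : IsMetricAt (chartForm I g.inner x) y := by
  refine ⟨contDiffAt_chartForm g hy, Filter.Eventually.of_forall fun z u v ↦ ?_, fun v hv ↦ ?_⟩
  · rw [chartForm_apply, chartForm_apply]
    exact g.symm _ _ _
  · rw [chartForm_apply]
    refine g.pos _ _ fun h ↦ hv (injective_mfderiv_extChartAt_symm hy ?_)
    exact h.trans (map_zero (mfderiv 𝓘(ℝ, E) I (extChartAt I x).symm y)).symm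

theorem eventually_isMetricAt_chartForm (g : RiemMetric I M) {x : M} {y : E}
    (hy : y ∈ (extChartAt I x).target) :
    ∀ᶠ z in nhds y, IsMetricAt (chartForm I g.inner x) z := by
  filter_upwards [(isOpen_extChartAt_target x).mem_nhds hy] with z hz
  exact isMetricAt_chartForm g hz

theorem contDiffAt_chartEndo (φ : AlmostParacomplex I M) {x : M} {y : E}
    (hy : y ∈ (extChartAt I x).target) : ContDiffAt ℝ ∞ (chartEndo I φ.endo x) y :=
  contDiffAt_clm_of_forall_apply (isOpen_extChartAt_target x)
    (fun _ hz a ↦ contDiffAt_chartEndo_apply φ hz a) hy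

omit [FiniteDimensional ℝ E] in
theorem mfderiv_symm_chartEndo (φ : AlmostParacomplex I M) {x : M} {y : E}
    (hy : y ∈ (extChartAt I x).target) (a : E) :
    mfderiv 𝓘(ℝ, E) I (extChartAt I x).symm y (chartEndo I φ.endo x y a) =
      φ.endo ((extChartAt I x).symm y) (mfderiv 𝓘(ℝ, E) I (extChartAt I x).symm y a) :=
  mfderiv_symm_mfderiv_extChartAt hy _

omit [FiniteDimensional ℝ E] in
/-- The expressions of a form in two charts are related by the change of coordinates. -/
theorem chartForm_transition (G : ∀ x : M, TangentSpace I x →L[ℝ] TangentSpace I x →L[ℝ] ℝ)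
    {x x' : M} {y : E} (hy : y ∈ (extChartAt I x).target)
    (hx' : (extChartAt I x).symm y ∈ (extChartAt I x').source) (a b : E) :
    chartForm I G x y a b =
      chartForm I G x' ((extChartAt I x' ∘ (extChartAt I x).symm) y)
        (fderiv ℝ (extChartAt I x' ∘ (extChartAt I x).symm) y a)
        (fderiv ℝ (extChartAt I x' ∘ (extChartAt I x).symm) y b) := by
  -- The tangent spaces depend on the point, so the forms at two equal points are compared on the
  -- model space `E`.
  have hG (p q : M) (hpq : p = q) (v w : E) :
      (G p : E →L[ℝ] E →L[ℝ] ℝ) v w = (G q : E →L[ℝ] E →L[ℝ] ℝ) v w := by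
    subst hpq
    rfl
  -- Chain rule for the inverse chart at `x'` composed with the transition, which is the inverse
  -- chart at `x` near `y`.
  have hT (v : E) : (mfderiv 𝓘(ℝ, E) I (extChartAt I x').symm
      ((extChartAt I x' ∘ (extChartAt I x).symm) y)
      (fderiv ℝ (extChartAt I x' ∘ (extChartAt I x).symm) y v) : E) =
      mfderiv 𝓘(ℝ, E) I (extChartAt I x).symm y v := by
    have h1 : (extChartAt I x' ∘ (extChartAt I x).symm) y ∈ (extChartAt I x').target :=
      (extChartAt I x').map_source hx'
    have h2 := mfderiv_comp y (mdifferentiableAt_extChartAt_symm h1)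
      (((contDiffAt_transition hy hx').differentiableAt (by simp)).mdifferentiableAt)
    rw [mfderiv_eq_fderiv] at h2
    have h3 : (extChartAt I x').symm ∘ (extChartAt I x' ∘ (extChartAt I x).symm) =ᶠ[nhds y]
        (extChartAt I x).symm := by
      have h4 : ∀ᶠ z in nhds y, (extChartAt I x).symm z ∈ (extChartAt I x').source :=
        (contMDiffAt_extChartAt_symm' hy).continuousAt.eventually
          ((isOpen_extChartAt_source x').mem_nhds hx')
      filter_upwards [h4] with z hz
      exact (extChartAt I x').left_inv hz
    have h5 : (mfderiv 𝓘(ℝ, E) I ((extChartAt I x').symm ∘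
        (extChartAt I x' ∘ (extChartAt I x).symm)) y : E →L[ℝ] E) =
        (mfderiv 𝓘(ℝ, E) I (extChartAt I x).symm y : E →L[ℝ] E) := h3.mfderiv_eq
    rw [← h5]
    exact (congrArg (fun L : E →L[ℝ] E ↦ L v) h2).symm
  rw [chartForm_apply, chartForm_apply]
  refine Eq.trans ?_ (congrArg₂ (fun v w : E ↦ (G ((extChartAt I x').symm
    ((extChartAt I x' ∘ (extChartAt I x).symm) y)) : E →L[ℝ] E →L[ℝ] ℝ) v w) (hT a) (hT b)).symm
  exact hG _ _ ((extChartAt I x').left_inv hx').symm _ _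

/-- The transformation law of the Christoffel map of a metric, from the chart at `x` to the chart at
a nearby point. -/
theorem christoffelL_transition (g : RiemMetric I M) {x x' : M} {y : E}
    (hy : y ∈ (extChartAt I x).target)
    (hx' : (extChartAt I x).symm y ∈ (extChartAt I x').source) (u v : E) :
    fderiv ℝ (extChartAt I x' ∘ (extChartAt I x).symm) y
        (christoffelL (chartForm I g.inner x) y u v) =
      fderiv ℝ (fderiv ℝ (extChartAt I x' ∘ (extChartAt I x).symm)) y u v +
        christoffelL (chartForm I g.inner x') (extChartAt I x' ((extChartAt I x).symm y))
          (fderiv ℝ (extChartAt I x' ∘ (extChartAt I x).symm) y u)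
          (fderiv ℝ (extChartAt I x' ∘ (extChartAt I x).symm) y v) := by
  refine christoffelL_pullback (τ := extChartAt I x' ∘ (extChartAt I x).symm)
    (isMetricAt_chartForm g hy) (isMetricAt_chartForm g ((extChartAt I x').map_source hx'))
    (contDiffAt_transition hy hx') ?_ ?_ u v
  · have h4 : ∀ᶠ z in nhds y, (extChartAt I x).symm z ∈ (extChartAt I x').source :=
      (contMDiffAt_extChartAt_symm' hy).continuousAt.eventually
        ((isOpen_extChartAt_source x').mem_nhds hx')
    filter_upwards [h4, (isOpen_extChartAt_target x).mem_nhds hy] with z h1 h2 a b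
    exact chartForm_transition _ h2 h1 a b
  · intro w
    have h1 : (mfderiv I 𝓘(ℝ, E) (extChartAt I x') ((extChartAt I x).symm y)).IsInvertible :=
      isInvertible_mfderiv_extChartAt hx'
    obtain ⟨v, hv⟩ := h1.surjective w
    obtain ⟨a, rfl⟩ := surjective_mfderiv_extChartAt_symm hy v
    exact ⟨a, (mfderiv_extChartAt_symm_apply hy hx' a).symm.trans hv⟩

omit [FiniteDimensional ℝ E] in
/-- The changes of coordinates of the tangent bundle. -/
theorem extChartAt_tangent_transition (u u' : TangentBundle I M) {y : E}
    (hy : y ∈ (extChartAt I u.proj).target)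
    (hu' : (extChartAt I u.proj).symm y ∈ (extChartAt I u'.proj).source) (w : E) :
    extChartAt I.tangent u' ((extChartAt I.tangent u).symm (y, w)) =
      ((extChartAt I u'.proj ∘ (extChartAt I u.proj).symm) y,
        fderiv ℝ (extChartAt I u'.proj ∘ (extChartAt I u.proj).symm) y w) := by
  rw [extChartAt_tangent_symm_apply u hy w]
  exact (extChartAt_tangent_apply u' hu' _).trans
    (Prod.ext rfl (mfderiv_extChartAt_symm_apply hy hu' w))

-- The derivative of the tangent map of `τ` is block triangular. Its off-diagonal term `D²τ(a, w)`
-- is matched later by the inhomogeneous term in the law for `Γ`.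
omit [FiniteDimensional ℝ E] in
theorem hasFDerivAt_tangentMap {τ : E → E} {y : E} (hτ : ContDiffAt ℝ ∞ τ y) (w : E) :
    ∃ L : E × E →L[ℝ] E × E, HasFDerivAt (fun z : E × E ↦ (τ z.1, fderiv ℝ τ z.1 z.2)) L (y, w) ∧
      ∀ a b, L (a, b) = (fderiv ℝ τ y a, fderiv ℝ (fderiv ℝ τ) y a w + fderiv ℝ τ y b) := by
  have h3 : HasFDerivAt τ (fderiv ℝ τ y) y := (hτ.differentiableAt (by simp)).hasFDerivAt
  have h4 : HasFDerivAt (fderiv ℝ τ) (fderiv ℝ (fderiv ℝ τ) y) y :=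
    ((hτ.fderiv_right (m := ∞) (by simp)).differentiableAt (by simp)).hasFDerivAt
  have h5 : HasFDerivAt (fun z : E × E ↦ τ z.1) _ (y, w) := h3.comp (y, w) hasFDerivAt_fst
  have h6 : HasFDerivAt (fun z : E × E ↦ fderiv ℝ τ z.1) _ (y, w) :=
    h4.comp (y, w) hasFDerivAt_fst
  refine ⟨_, h5.prodMk (h6.clm_apply (hasFDerivAt_snd (p := (y, w)))), fun a b ↦ ?_⟩
  simp [add_comm]

end Charts

/-! ### The Berger–Sasaki metric in the induced charts of the tangent bundle. -/

section TangentBundleCharts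

variable {E : Type*} [NormedAddCommGroup E] [NormedSpace ℝ E]
  {H : Type*} [TopologicalSpace H] {I : ModelWithCorners ℝ E H} [I.Boundaryless]
  {M : Type*} [TopologicalSpace M] [ChartedSpace H M] [IsManifold I ∞ M]

/-- The derivative of the inverse of a chart of the tangent bundle. -/
theorem mfderiv_extChartAt_tangent_symm (u : TangentBundle I M) {y : E}
    (hy : y ∈ (extChartAt I u.proj).target) (w a b : E) (τ : E → E)
    (hτ : τ = extChartAt I ((extChartAt I u.proj).symm y) ∘ (extChartAt I u.proj).symm) :
    (mfderiv 𝓘(ℝ, E × E) I.tangent (extChartAt I.tangent u).symm (y, w) (a, b) : E × E) =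
      (fderiv ℝ τ y a, fderiv ℝ (fderiv ℝ τ) y a w + fderiv ℝ τ y b) := by
  have hx' := mem_extChartAt_source (I := I) ((extChartAt I u.proj).symm y)
  have hτs : ContDiffAt ℝ ∞ τ y := hτ ▸ contDiffAt_transition hy hx'
  have h1 := mfderiv_extChartAt_symm_eq (I := I.tangent) (mem_extChartAt_tangent_target u hy w)
  have h2 : (extChartAt I.tangent ((extChartAt I.tangent u).symm (y, w)) ∘
      (extChartAt I.tangent u).symm) =ᶠ[nhds (y, w)] fun z ↦ (τ z.1, fderiv ℝ τ z.1 z.2) := by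
    have h4 : ∀ᶠ z in nhds y,
        (extChartAt I u.proj).symm z ∈ (extChartAt I ((extChartAt I u.proj).symm y)).source :=
      (contMDiffAt_extChartAt_symm' hy).continuousAt.eventually
        ((isOpen_extChartAt_source _).mem_nhds hx')
    have h5 := (continuous_fst.tendsto (y, w)).eventually h4
    have h6 := (continuous_fst.tendsto (y, w)).eventually
      ((isOpen_extChartAt_target u.proj).mem_nhds hy)
    filter_upwards [h5, h6] with z h7 h8
    rw [hτ]
    have h9 := extChartAt_tangent_transition u ((extChartAt I.tangent u).symm (y, w)) h8 h7 z.2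
    exact h9
  obtain ⟨L, hL, hL'⟩ := hasFDerivAt_tangentMap hτs w
  have h3 := h2.fderiv_eq.trans hL.fderiv
  have h4 := h1.trans h3
  have h5 := congrArg (fun L : E × E →L[ℝ] E × E ↦ L (a, b)) h4
  exact h5.trans (hL' a b)

theorem horizontalPart_coe (u : TangentBundle I M) (ξ : TangentSpace I.tangent u) :
    (horizontalPart u ξ : E) = (ξ : E × E).1 :=
  congrArg (fun L : E × E →L[ℝ] E ↦ L ξ) (horizontalPart_eq u)

omit [I.Boundaryless] in
theorem verticalPart_coe (g : RiemMetric I M) (u : TangentBundle I M)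
    (ξ : TangentSpace I.tangent u) :
    (verticalPart g u ξ : E) = (ξ : E × E).2 +
      christoffelL (chartForm I g.inner u.proj) (extChartAt I u.proj u.proj) (u.snd : E)
        (ξ : E × E).1 := by
  have h1 : tangentCoords u ξ = (ξ : E × E) := congrArg (fun L : E × E →L[ℝ] E × E ↦ L ξ)
    (tangentCoords_eq u)
  have h2 (X : TangentSpace I u.proj) : baseCoords u.proj X = (X : E) :=
    congrArg (fun L : E →L[ℝ] E ↦ L X) (baseCoords_eq u.proj)
  have h3 (X : E) : (baseCoords (I := I) u.proj).inverse X = X :=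
    (congrArg _ (h2 X).symm).trans (baseCoords_inverse u.proj X)
  rw [verticalPart_apply, h1, h2, h3]
  rfl

variable [FiniteDimensional ℝ E]

-- The vertical parts `β`, `β'` are given by equations so that they can be supplied as images under
-- `dτ` of vertical parts in another chart.
omit [FiniteDimensional ℝ E] in
theorem bergerSasaki_coe (φ : AlmostParacomplex I M) (g : RiemMetric I M) (δ : ℝ)
    (u : TangentBundle I M) (ξ η : E × E) (β β' : E)
    (hβ : β = ξ.2 + christoffelL (chartForm I g.inner u.proj) (extChartAt I u.proj u.proj)
      (u.snd : E) ξ.1)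
    (hβ' : β' = η.2 + christoffelL (chartForm I g.inner u.proj) (extChartAt I u.proj u.proj)
      (u.snd : E) η.1) :
    (bergerSasaki φ g δ u : E × E →L[ℝ] E × E →L[ℝ] ℝ) ξ η =
      (g.inner u.proj : E →L[ℝ] E →L[ℝ] ℝ) ξ.1 η.1 +
      ((g.inner u.proj : E →L[ℝ] E →L[ℝ] ℝ) β β' +
        δ ^ 2 * ((g.inner u.proj : E →L[ℝ] E →L[ℝ] ℝ) (φ.endo u.proj u.snd) β *
          (g.inner u.proj : E →L[ℝ] E →L[ℝ] ℝ) (φ.endo u.proj u.snd) β')) := by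
  refine (bergerSasaki_apply φ g δ u ξ η).trans ?_
  have h1 : verticalPart g u ξ = β := (verticalPart_coe g u ξ).trans hβ.symm
  have h2 : verticalPart g u η = β' := (verticalPart_coe g u η).trans hβ'.symm
  have h3 : horizontalPart u ξ = ξ.1 := horizontalPart_coe u ξ
  have h4 : horizontalPart u η = η.1 := horizontalPart_coe u η
  rw [h1, h2, h3, h4]

/-- The vertical part of the image of `(a, b)` under the change of coordinates at `(y, w)`. -/
theorem verticalPart_transition (g : RiemMetric I M) {x : M} {y : E}
    (hy : y ∈ (extChartAt I x).target) (w a b : E) (τ : E → E)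
    (hτ : τ = extChartAt I ((extChartAt I x).symm y) ∘ (extChartAt I x).symm) :
    fderiv ℝ τ y (localVerticalPart (chartForm I g.inner x) (y, w) (a, b)) =
      (fderiv ℝ (fderiv ℝ τ) y a w + fderiv ℝ τ y b) +
        christoffelL (chartForm I g.inner ((extChartAt I x).symm y))
          (extChartAt I ((extChartAt I x).symm y) ((extChartAt I x).symm y))
          (fderiv ℝ τ y w) (fderiv ℝ τ y a) := by
  have hmem := mem_extChartAt_source (I := I) ((extChartAt I x).symm y)
  have hτs : ContDiffAt ℝ ∞ τ y := hτ ▸ contDiffAt_transition hy hmem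
  have hsymm : fderiv ℝ (fderiv ℝ τ) y a w = fderiv ℝ (fderiv ℝ τ) y w a :=
    hτs.isSymmSndFDerivAt (by simpa using ENat.LEInfty.out) a w
  have h := christoffelL_transition g hy hmem w a
  rw [← hτ] at h
  have h1 : localVerticalPart (chartForm I g.inner x) (y, w) (a, b) =
    b + christoffelL (chartForm I g.inner x) y w a := rfl
  -- The second derivative of `τ` in the law for `Γ` is exactly the one in the tangent map, so
  -- vertical parts transform by `dτ` alone.
  rw [h1, map_add, h, hsymm]
  abel

/-- The Berger type deformed Sasaki metric in the charts of the tangent bundle. -/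
theorem chartForm_bergerSasaki (φ : AlmostParacomplex I M) (g : RiemMetric I M) (δ : ℝ)
    (u : TangentBundle I M) {y : E} (hy : y ∈ (extChartAt I u.proj).target) (w : E) :
    chartForm I.tangent (bergerSasaki φ g δ) u (y, w) =
      localBergerSasaki (chartForm I g.inner u.proj) (chartEndo I φ.endo u.proj) δ (y, w) := by
  have hG (p q : TangentBundle I M) (hpq : p = q) (v w : E × E) :
      (bergerSasaki φ g δ p : E × E →L[ℝ] E × E →L[ℝ] ℝ) v w =
        (bergerSasaki φ g δ q : E × E →L[ℝ] E × E →L[ℝ] ℝ) v w := by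
    subst hpq
    rfl
  -- `bergerSasaki` is defined at each point by the chart centred at that point; `τ` passes from the
  -- fixed chart to the one centred at the base point over `y`.
  obtain ⟨τ, hτ⟩ : ∃ τ, τ = extChartAt I ((extChartAt I u.proj).symm y) ∘
    (extChartAt I u.proj).symm := ⟨_, rfl⟩
  have hT (a : E) : (mfderiv 𝓘(ℝ, E) I (extChartAt I u.proj).symm y a : E) = fderiv ℝ τ y a :=
    hτ ▸ congrArg (fun L : E →L[ℝ] E ↦ L a) (mfderiv_extChartAt_symm_eq hy)
  have hg (a b : E) : chartForm I g.inner u.proj y a b =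
      (g.inner ((extChartAt I u.proj).symm y) : E →L[ℝ] E →L[ℝ] ℝ)
        (fderiv ℝ τ y a) (fderiv ℝ τ y b) := by
    rw [chartForm_apply, ← hT, ← hT]
  have hΦ : (φ.endo ((extChartAt I u.proj).symm y)
      (mfderiv 𝓘(ℝ, E) I (extChartAt I u.proj).symm y w) : E) =
      fderiv ℝ τ y (chartEndo I φ.endo u.proj y w) :=
    (mfderiv_symm_chartEndo φ hy w).symm.trans (hT _)
  have key (a b a' b' : E) : chartForm I.tangent (bergerSasaki φ g δ) u (y, w) (a, b) (a', b') =
      localBergerSasaki (chartForm I g.inner u.proj) (chartEndo I φ.endo u.proj) δ (y, w) (a, b)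
        (a', b') := by
    have h1 := mfderiv_extChartAt_tangent_symm u hy w a b τ hτ
    have h2 := mfderiv_extChartAt_tangent_symm u hy w a' b' τ hτ
    have h3 := congrArg₂ (fun ξ η : E × E ↦
      (bergerSasaki φ g δ ((extChartAt I.tangent u).symm (y, w)) :
        E × E →L[ℝ] E × E →L[ℝ] ℝ) ξ η) h1 h2
    rw [chartForm_apply]
    refine h3.trans ((hG _ _ (extChartAt_tangent_symm_apply u hy w) _ _).trans ?_)
    have hv (a b : E) : fderiv ℝ τ y (localVerticalPart (chartForm I g.inner u.proj) (y, w) (a, b)) =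
        (fderiv ℝ (fderiv ℝ τ) y a w + fderiv ℝ τ y b) +
          christoffelL (chartForm I g.inner ((extChartAt I u.proj).symm y))
            (extChartAt I ((extChartAt I u.proj).symm y) ((extChartAt I u.proj).symm y))
            (mfderiv 𝓘(ℝ, E) I (extChartAt I u.proj).symm y w : E) (fderiv ℝ τ y a) := by
      rw [hT]
      exact verticalPart_transition g hy w a b τ hτ
    have h4 := bergerSasaki_coe φ g δ ⟨(extChartAt I u.proj).symm y,
      mfderiv 𝓘(ℝ, E) I (extChartAt I u.proj).symm y w⟩
      (fderiv ℝ τ y a, fderiv ℝ (fderiv ℝ τ) y a w + fderiv ℝ τ y b)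
      (fderiv ℝ τ y a', fderiv ℝ (fderiv ℝ τ) y a' w + fderiv ℝ τ y b')
      _ _ (hv a b) (hv a' b')
    refine h4.trans ?_
    rw [localBergerSasaki_apply, localBergerForm_apply, hg, hg, hg, hg, ← hΦ]
  exact ContinuousLinearMap.ext fun v ↦ ContinuousLinearMap.ext fun v' ↦ key v.1 v.2 v'.1 v'.2

end TangentBundleCharts

/-! ### Second fundamental forms of the projection and of the identity, and the equivalence. -/

section TotallyGeodesic

variable {E : Type*} [NormedAddCommGroup E] [NormedSpace ℝ E]

theorem christoffelL_congr {g g' : E → E →L[ℝ] E →L[ℝ] ℝ} {y : E} (h : g =ᶠ[nhds y] g') :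
    christoffelL g y = christoffelL g' y := by
  rw [christoffelL, christoffelL, h.fderiv_eq, h.self_of_nhds]

variable [FiniteDimensional ℝ E] {g : E → E →L[ℝ] E →L[ℝ] ℝ} {Φ : E → E →L[ℝ] E} {δ : ℝ}

theorem fst_christoffelL_localBergerSasaki_of_curvature_eq_zero {p : E × E}
    (hg : ∀ᶠ z in nhds p.1, IsMetricAt g z) (hΦ : ContDiffAt ℝ ∞ Φ p.1)
    (hpar : ∀ u w, covDerivEndo g Φ p.1 u w = 0) (hR : ∀ u v w, curvature g p.1 u v w = 0)
    (u v : E × E) :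
    (christoffelL (localBergerSasaki g Φ δ) p u v).1 = christoffelL g p.1 u.1 v.1 := by
  refine hg.self_of_nhds.eq_of_inner fun c ↦ ?_
  have h := inner_christoffelL_localBergerSasaki (δ := δ) hg hΦ hpar u v c
  rw [hR, hR, map_zero, map_zero] at h
  linarith

/-- On two horizontal lifts the vertical parts vanish, and with them both curvature terms. -/
theorem eq_christoffelL_of_fst_christoffelL_localBergerSasaki {p : E × E}
    (hg : ∀ᶠ z in nhds p.1, IsMetricAt g z) (hΦ : ContDiffAt ℝ ∞ Φ p.1)
    (hpar : ∀ u w, covDerivEndo g Φ p.1 u w = 0) {Γ : E →L[ℝ] E →L[ℝ] E}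
    (hΓ : ∀ u v, (christoffelL (localBergerSasaki g Φ δ) p u v).1 = Γ u.1 v.1) (a b : E) :
    Γ a b = christoffelL g p.1 a b := by
  refine hg.self_of_nhds.eq_of_inner fun c ↦ ?_
  have h := inner_christoffelL_localBergerSasaki (δ := δ) hg hΦ hpar
    (a, - christoffelL g p.1 p.2 a) (b, - christoffelL g p.1 p.2 b) c
  have h0 (a : E) : localVerticalPart g p (a, - christoffelL g p.1 p.2 a) = 0 := by
    simp [localVerticalPart]
  rw [h0, h0, hΓ, map_zero, zero_apply, zero_apply] at h
  linarith

/-- On the horizontal lift of `a` and the vertical vector `R(a, c)w`, the `Γ` terms vanish because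
one base component is zero. What is left is the Berger form of `R(a, c)w` with itself. -/
theorem curvature_eq_zero_of_fst_christoffelL_localBergerSasaki {p : E × E}
    (hg : ∀ᶠ z in nhds p.1, IsMetricAt g z) (hΦ : ContDiffAt ℝ ∞ Φ p.1)
    (hpar : ∀ u w, covDerivEndo g Φ p.1 u w = 0) {Γ : E →L[ℝ] E →L[ℝ] E}
    (hΓ : ∀ u v, (christoffelL (localBergerSasaki g Φ δ) p u v).1 = Γ u.1 v.1) (a c : E) :
    curvature g p.1 a c p.2 = 0 := by
  by_contra hne
  have hpos := localBergerForm_pos (Φ := Φ) (δ := δ) hg.self_of_nhds _ hne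
  have h := inner_christoffelL_localBergerSasaki (δ := δ) hg hΦ hpar
    (a, - christoffelL g p.1 p.2 a) (0, curvature g p.1 a c p.2) c
  have h1 : localVerticalPart g p (a, - christoffelL g p.1 p.2 a) = 0 := by
    simp [localVerticalPart]
  have h2 : localVerticalPart g p (0, curvature g p.1 a c p.2) = curvature g p.1 a c p.2 := by
    simp [localVerticalPart]
  simp only [h1, h2, hΓ, map_zero, zero_apply] at h
  linarith

variable {H : Type*} [TopologicalSpace H] {I : ModelWithCorners ℝ E H} [I.Boundaryless]
  {M : Type*} [TopologicalSpace M] [ChartedSpace H M] [IsManifold I ∞ M]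

omit [FiniteDimensional ℝ E] [I.Boundaryless] in
theorem extChartAt_tangent_self (u : TangentBundle I M) :
    extChartAt I.tangent u u = ((extChartAt I u.proj u.proj, u.snd) : E × E) := by
  refine (extChartAt_tangent_apply u (mem_extChartAt_source u.proj) u.snd).trans ?_
  exact Prod.ext rfl (congrArg (fun L : E →L[ℝ] E ↦ L u.snd) mfderiv_extChartAt_self)

omit [FiniteDimensional ℝ E] in
theorem writtenInExtChartAt_proj_eventuallyEq (u : TangentBundle I M) :
    writtenInExtChartAt I.tangent I u (TotalSpace.proj : TangentBundle I M → M)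
      =ᶠ[nhds ((extChartAt I u.proj u.proj, u.snd) : E × E)] Prod.fst := by
  have h := (continuous_fst.tendsto ((extChartAt I u.proj u.proj, u.snd) : E × E)).eventually
    (extChartAt_target_mem_nhds (I := I) u.proj)
  filter_upwards [h] with z hz
  have h1 := congrArg (fun q : TangentBundle I M ↦ extChartAt I u.proj q.proj)
    (extChartAt_tangent_symm_apply u hz z.2)
  exact h1.trans ((extChartAt I u.proj).right_inv hz)

omit [FiniteDimensional ℝ E] [IsManifold I ∞ M] in
theorem writtenInExtChartAt_id_eventuallyEq (x : M) :
    writtenInExtChartAt I I x (id : M → M) =ᶠ[nhds (extChartAt I x x)] id := by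
  filter_upwards [extChartAt_target_mem_nhds (I := I) x] with z hz
  exact (extChartAt I x).right_inv hz

/-- A point of `TM` is a pair `(x, w)`, and the Christoffel map depends only on the germ of the
metric, so agreement of the two expressions near the chart centre suffices. -/
theorem isTotallyGeodesic_proj_iff (φ : AlmostParacomplex I M) (g h : RiemMetric I M) (δ : ℝ) :
    IsTotallyGeodesic I.tangent I (bergerSasaki φ g δ) h.inner
        (TotalSpace.proj : TangentBundle I M → M) ↔
      ∀ (x : M) (w : E) (ξ η : E × E),
        (christoffelL (localBergerSasaki (chartForm I g.inner x) (chartEndo I φ.endo x) δ)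
          (extChartAt I x x, w) ξ η).1 =
          christoffelL (chartForm I h.inner x) (extChartAt I x x) ξ.1 η.1 := by
  have key (u : TangentBundle I M) (ξ η : E × E) :
      secondFundamentalForm (chartForm I.tangent (bergerSasaki φ g δ) u)
        (chartForm I h.inner u.proj)
        (writtenInExtChartAt I.tangent I u (TotalSpace.proj : TangentBundle I M → M))
        (extChartAt I.tangent u u) ξ η =
      christoffelL (chartForm I h.inner u.proj) (extChartAt I u.proj u.proj) ξ.1 η.1 -
        (christoffelL (localBergerSasaki (chartForm I g.inner u.proj)
          (chartEndo I φ.endo u.proj) δ) ((extChartAt I u.proj u.proj, u.snd) : E × E) ξ η).1 := by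
    have h1 : chartForm I.tangent (bergerSasaki φ g δ) u
        =ᶠ[nhds ((extChartAt I u.proj u.proj, u.snd) : E × E)]
        localBergerSasaki (chartForm I g.inner u.proj) (chartEndo I φ.endo u.proj) δ := by
      have h := (continuous_fst.tendsto ((extChartAt I u.proj u.proj, u.snd) : E × E)).eventually
        (extChartAt_target_mem_nhds (I := I) u.proj)
      filter_upwards [h] with z hz
      exact chartForm_bergerSasaki φ g δ u hz z.2
    rw [extChartAt_tangent_self, ← christoffelL_congr h1]
    exact secondFundamentalForm_of_eventuallyEq_fst (writtenInExtChartAt_proj_eventuallyEq u) ξ η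
  constructor
  · intro hπ x w ξ η
    exact (sub_eq_zero.1 ((key ⟨x, w⟩ ξ η).symm.trans (hπ.2 ⟨x, w⟩ ξ η))).symm
  · intro hπ
    refine ⟨contMDiff_proj (TangentSpace I), fun u ξ η ↦ (key u ξ η).trans ?_⟩
    exact sub_eq_zero.2 (hπ u.proj u.snd ξ η).symm

omit [FiniteDimensional ℝ E] in
theorem isTotallyGeodesic_id_iff (g h : RiemMetric I M) :
    IsTotallyGeodesic I I g.inner h.inner (id : M → M) ↔
      ∀ (x : M) (a b : E), christoffelL (chartForm I h.inner x) (extChartAt I x x) a b =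
        christoffelL (chartForm I g.inner x) (extChartAt I x x) a b := by
  have key (x : M) (a b : E) := secondFundamentalForm_of_eventuallyEq_id
    (g := chartForm I g.inner x) (g' := chartForm I h.inner x)
    (writtenInExtChartAt_id_eventuallyEq (I := I) x) a b
  constructor
  · intro hid x a b
    exact sub_eq_zero.1 ((key x a b).symm.trans (hid.2 x a b))
  · intro hid
    exact ⟨contMDiff_id, fun x a b ↦ (key x a b).trans (sub_eq_zero.2 (hid x a b))⟩

/-- The projection from the tangent bundle with the Berger type deformed Sasaki metric is totally
geodesic if and only if the base is locally flat and the identity is totally geodesic. -/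
theorem isTotallyGeodesic_proj_iff_isLocallyFlat (φ : AlmostParacomplex I M) (g h : RiemMetric I M)
    (hg : IsParallel I g.inner φ.endo) (δ : ℝ) :
    IsTotallyGeodesic I.tangent I (bergerSasaki φ g δ) h.inner
        (TotalSpace.proj : TangentBundle I M → M) ↔
      IsLocallyFlat I g.inner ∧ IsTotallyGeodesic I I g.inner h.inner (id : M → M) := by
  rw [isTotallyGeodesic_proj_iff, isTotallyGeodesic_id_iff]
  have hm (x : M) := eventually_isMetricAt_chartForm g (mem_extChartAt_target (I := I) x)
  have hΦ (x : M) := contDiffAt_chartEndo φ (mem_extChartAt_target (I := I) x)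
  constructor
  · intro hπ
    refine ⟨fun x u v w ↦ ?_, fun x a b ↦ ?_⟩
    -- The third argument of the curvature is the point of the fibre, so all points of `TM` are used
    -- here.
    · exact curvature_eq_zero_of_fst_christoffelL_localBergerSasaki
        (p := (extChartAt I x x, w)) (hm x) (hΦ x) (hg x) (hπ x w) u v
    -- Any point of the fibre would do; the zero vector is chosen.
    · exact eq_christoffelL_of_fst_christoffelL_localBergerSasaki
        (p := (extChartAt I x x, 0)) (hm x) (hΦ x) (hg x) (hπ x 0) a b
  · rintro ⟨hR, hid⟩ x w ξ η
    rw [hid]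
    exact fst_christoffelL_localBergerSasaki_of_curvature_eq_zero
      (p := (extChartAt I x x, w)) (hm x) (hΦ x) (hg x) (hR x) ξ η

end TotallyGeodesic
end

end BergerSasaki

theorem mainTheorem6 {k : ℕ} {M : Type*} [TopologicalSpace M]
    [ChartedSpace (EuclideanSpace ℝ (Fin (2 * k))) M] [IsManifold (𝓡 (2 * k)) ∞ M]
    (φ φ₁ : BergerSasaki.AlmostParacomplex (𝓡 (2 * k)) M)
    (g h : BergerSasaki.RiemMetric (𝓡 (2 * k)) M)
    (hg : BergerSasaki.IsAntiParaKahler φ g)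
    (hh : BergerSasaki.IsAntiParaHermitian φ₁ h)
    (δ : ℝ) :
    BergerSasaki.IsTotallyGeodesic (𝓡 (2 * k)).tangent (𝓡 (2 * k))
        (BergerSasaki.bergerSasaki φ g δ) h.inner
        (TotalSpace.proj : TangentBundle (𝓡 (2 * k)) M → M) ↔
      BergerSasaki.IsLocallyFlat (𝓡 (2 * k)) g.inner ∧
        BergerSasaki.IsTotallyGeodesic (𝓡 (2 * k)) (𝓡 (2 * k)) g.inner h.inner (id : M → M) :=
  BergerSasaki.isTotallyGeodesic_proj_iff_isLocallyFlat φ g h hg.2 δ
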